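/- Let $S$ be a closed connected topological surface with a finite cellular (CW) decomposition $\Sigma=(V,E,F)$, and let $\Phi: E\to(0,\frac{\pi}{2})$ be a weight. For an edge $e$ let $f_1(e),f_2(e)\in F$ be the (possibly equal) faces on its two sides; for $A\subset F$ let $E_A$ be the set of edges with at least one of $f_1(e),f_2(e)$ in $A$. A vector $k\in\mathbb{R}_{\ge 0}^{F}$ is regarded as the spherical conical metric on $S$ whose circle pattern has a disk of radius $r_i=\operatorname{arccot} k_i\in(0,\frac{\pi}{2}]$ (hence of boundary geodesic curvature $k_i$) for each face $i$, and in which the disks of $f_1(e)$ and $f_2(e)$ overlap, for each edge $e$, in a spherical bigon of interior angle $\Phi(e)$ (metrics that are isometric, compatibly with their circle patterns and isotopically to the identity, have the same $k$). The metric is called a degenerated circle pattern metric if some $k_i=0$. For such $k$, the bigon of $e$ is the intersection of two disks of radii $r_{f_1(e)},r_{f_2(e)}$ in the unit sphere $\mathbb{S}^2$ whose interior angle is $\Phi(e)$; the total geodesic curvature of its side on the circle of the face $i$ is $k_i$ times the length of that side, and the total geodesic curvature $L_i(k)$ of the face $i$ is the sum of these numbers over all bigon sides that belong to $i$ (both sides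 of the bigon of $e$ if $f_1(e)=f_2(e)=i$). Let $I\subset F$ with $I\ne\emptyset$ and $I\ne F$. Put $$\mathbb{R}^{F}_{I}=\{k\in\mathbb{R}^{F} : k_i>0 \text{ for } i\in I,\ k_i=0 \text{ for } i\notin I\},$$ $$\mathcal{L}_{I}=\Big\{L\in\mathbb{R}^{F}_{I} : \sum_{f\in A}L_f<2\sum_{e\in E_{A}}\Phi(e)\ \text{ for all } \emptyset\ne A\subset I\Big\}.$$ Let $\hat L\in\mathcal{L}_{I}$. Then there is exactly one degenerated circle pattern metric $\hat k$ with total geodesic curvature $L(\hat k)=\hat L$, and $\hat k\in\mathbb{R}^{F}_{I}$. For every initial value $k(0)\in\mathbb{R}_{>0}^{F}$, the prescribed combinatorial Ricci flow $$\frac{dk_i}{dt}=-(L_i(k)-\hat L_i)\,k_i\quad(i\in I),\qquad \frac{dk_i}{dt}=-L_i(k)\,k_i\quad(i\in F\setminus I)$$ has a solution $k(t)\in\mathbb{R}_{>0}^{F}$ for all $t\in[0,\infty)$; it is unique (every solution with the same initial value on an interval $[0,T)$ agrees with it there), and $k(t)\to\hat k$ as $t\to\infty$. In particular $k_i(t)\to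 0$ for every $i\in F\setminus I$. -/

import Mathlib

open Set Filter Topology MeasureTheory

noncomputable section

namespace CirclePattern

/-! ### Cellular decompositions of surfaces -/

/-- The 1-cells of a CW structure on the whole space `S`. -/
abbrev Edges (S : Type*) [TopologicalSpace S] [CWComplex (univ : Set S)] : Type _ :=
  RelCWComplex.cell (univ : Set S) 1

/-- The 2-cells of a CW structure on the whole space `S`. -/
abbrev Faces (S : Type*) [TopologicalSpace S] [CWComplex (univ : Set S)] : Type _ :=
  RelCWComplex.cell (univ : Set S) 2

/-- `f₁` and `f₂` are the 2-cells on the two sides of the 1-cell `e`: the open 1-cell `e` has an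
open neighbourhood homeomorphic to the plane, in which `e` is the horizontal axis, the upper half
plane lies in `f₁` and the lower half plane lies in `f₂`. The case `f₁ = f₂` is allowed. -/
def LieOnTwoSides {S : Type*} [TopologicalSpace S] [CWComplex (univ : Set S)]
    (e : Edges S) (f₁ f₂ : Faces S) : Prop :=
  ∃ ψ : ℝ × ℝ → S, IsOpenEmbedding ψ ∧
    ψ '' {z | z.2 = 0} = RelCWComplex.openCell 1 e ∧
    ψ '' {z | 0 < z.2} ⊆ RelCWComplex.openCell 2 f₁ ∧
    ψ '' {z | z.2 < 0} ⊆ RelCWComplex.openCell 2 f₂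

/-! ### Spherical bigons -/

/-- The point of the unit sphere at spherical distance `r` from the pole `p = (0, 0, 1)`, in the
tangent direction `(cos α, sin α, 0)` at `p`. -/
def fromPole (α r : ℝ) : EuclideanSpace ℝ (Fin 3) :=
  !₂[Real.sin r * Real.cos α, Real.sin r * Real.sin α, Real.cos r]

/-- The open spherical disk of radius `r` around a point `c` of the unit sphere. -/
def sphericalDisk (c : EuclideanSpace ℝ (Fin 3)) (r : ℝ) : Set (EuclideanSpace ℝ (Fin 3)) :=
  {x | ‖x‖ = 1 ∧ InnerProductGeometry.angle c x < r}

/-- The boundary circle of the spherical disk of radius `r` around `fromPole 0 r`, parametrized by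
the angle at the centre. The last two vectors are an orthonormal basis of the tangent plane at the
centre, and the parameter `0` gives the pole `p`. -/
def boundaryCircle (r θ : ℝ) : EuclideanSpace ℝ (Fin 3) :=
  Real.cos r • fromPole 0 r +
    Real.sin r • (Real.cos θ • !₂[-Real.cos r, 0, Real.sin r] + Real.sin θ • !₂[0, 1, 0])

/-- Let `D`, `D'` be disks of radii `r`, `r'` on the unit sphere whose boundaries pass through the
pole `p` and whose centres are seen from `p` in directions that make the angle `π - φ`. Then
`D ∩ D'` is a bigon with a vertex at `p` and with interior angle `φ`. This is the length of its side
on `∂D`, that is, of the arc of `∂D` inside `D'`. (The other side has length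
`bigonSideLength φ r' r`, by reflection.) -/
def bigonSideLength (φ r r' : ℝ) : ℝ :=
  ∫ θ in {θ | θ ∈ Ioc (-Real.pi) Real.pi ∧
      boundaryCircle r θ ∈ sphericalDisk (fromPole (Real.pi - φ) r') r'},
    ‖deriv (boundaryCircle r) θ‖

/-- The radius `r = arccot k` of a disk whose boundary has geodesic curvature `k = cot r`; it lies in
`(0, π/2]` for `k ≥ 0`. -/
def radius (k : ℝ) : ℝ := Real.pi / 2 - Real.arctan k

/-- The total geodesic curvature of the side, on the circle of geodesic curvature `k`, of a bigon of
angle `φ` between disks with geodesic curvatures `k` and `k'`. -/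
def sideCurvature (φ k k' : ℝ) : ℝ := bigonSideLength φ (radius k) (radius k') * k

/-! ### Total geodesic curvatures and flows

`E` and `F` are the sets of edges and faces, `f₁ e` and `f₂ e` are the faces on the two sides of the
edge `e`, and `Φ` is the weight. A metric is given by its vector `k` of geodesic curvatures. -/

section Combinatorial

variable {E F : Type*} [Fintype E] [DecidableEq F]

/-- The total geodesic curvature of the face `i`: the sum over all bigon sides belonging to `i`. If
`i` is on both sides of `e`, both sides of the bigon of `e` count. -/
def totalCurvature (f₁ f₂ : E → F) (Φ : E → ℝ) (k : F → ℝ) (i : F) : ℝ :=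
  ∑ e, ((if f₁ e = i then sideCurvature (Φ e) (k i) (k (f₂ e)) else 0) +
    (if f₂ e = i then sideCurvature (Φ e) (k i) (k (f₁ e)) else 0))

/-- The edges that are on the boundary of some face of `A`. -/
def boundaryEdges (f₁ f₂ : E → F) (A : Finset F) : Finset E :=
  Finset.univ.filter fun e => f₁ e ∈ A ∨ f₂ e ∈ A

/-- The set `𝓛_I` of prescribed total geodesic curvatures supported on the set of faces `I`. -/
def prescribedCurvatures (f₁ f₂ : E → F) (Φ : E → ℝ) (I : Finset F) : Set (F → ℝ) :=
  {L | (∀ i ∈ I, 0 < L i) ∧ (∀ i ∉ I, L i = 0) ∧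
    ∀ A ⊆ I, A.Nonempty → ∑ f ∈ A, L f < 2 * ∑ e ∈ boundaryEdges f₁ f₂ A, Φ e}

/-- `k` solves, on the time interval `J` and within the positive vectors, the prescribed
combinatorial Ricci flow for `Lhat` on the faces in `I` and for `0` on the other faces. -/
def IsFlowOn (f₁ f₂ : E → F) (Φ : E → ℝ) (I : Finset F) (Lhat : F → ℝ)
    (J : Set ℝ) (k : ℝ → F → ℝ) : Prop :=
  ∀ t ∈ J, ∀ i, 0 < k t i ∧
    HasDerivWithinAt (fun s => k s i)
      (if i ∈ I then -(totalCurvature f₁ f₂ Φ (k t) i - Lhat i) * k t i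
        else -totalCurvature f₁ f₂ Φ (k t) i * k t i) J t

end Combinatorial

/-- Degenerated circle pattern metrics: nonnegative geodesic curvatures, at least one of them `0`. -/
def IsDegenerated {F : Type*} (k : F → ℝ) : Prop := (∀ i, 0 ≤ k i) ∧ ∃ i, k i = 0

/-- The vectors that are positive on `I` and `0` elsewhere. -/
def stratum {F : Type*} (I : Finset F) : Set (F → ℝ) :=
  {k | (∀ i ∈ I, 0 < k i) ∧ ∀ i ∉ I, k i = 0}

end CirclePattern

end

/-!
Let `r = arccot k` and let `α` be half the angle under which a bigon side is seen from the centre of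
its disk. The total geodesic curvature of that side is `2 * cos r * α`, and
`cot α = cos r * (cos φ + k' / k) / sin φ`. Hence the total `L i` decreases in the variables other
than `k i`, and it increases along rays from the origin, since `x * arccot (x * y)` increases in
`x`.

Two vectors with the same totals are compared at a coordinate where their quotient is maximal, which
gives uniqueness. For existence take the greatest `k` with `L k ≤ Lhat` above a small vector
supported on `I`. It exists, for otherwise there are such `k` that tend to infinity on some set `A`
of faces and stay bounded on the others; then the totals on `A` add up, in the limit, to at least
`2 ∑ Φ e` over the edges of `A`, because bigons of large geodesic curvature look Euclidean and the
two half angles of a Euclidean bigon add up to `Φ e`.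

In the coordinates `s = log k` the flow is `s' = Lhat - L (exp s)`, with a bounded Lipschitz vector
field. By the maximum principle, `k` is eventually almost below every `l > 0` with `L l > Lhat`, and
almost above every `l ≥ 0` with `L l < Lhat` on its support; multiples of `khat`, shifted a little
in the first case, are such `l` close to `khat`.
-/

theorem exists_isGreatest_of_supClosed {α : Type*} [ConditionallyCompleteLattice α]
    [TopologicalSpace α] [SupConvergenceClass α] {P : Set α} (hP : SupClosed P)
    (hclosed : IsClosed P) (hne : P.Nonempty) (hbdd : BddAbove P) : ∃ m, IsGreatest P m := by
  have := hne.to_subtype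
  have : IsDirectedOrder P := ⟨fun a b => ⟨⟨a ⊔ b, hP a.2 b.2⟩, le_sup_left, le_sup_right⟩⟩
  have hlub : IsLUB (range ((↑) : P → α)) (sSup P) := by
    rw [Subtype.range_coe]
    exact isLUB_csSup hne hbdd
  have hlim : Tendsto ((↑) : P → α) atTop (𝓝 (sSup P)) :=
    tendsto_atTop_isLUB (fun _ _ h => h) hlub
  exact ⟨sSup P, hclosed.mem_of_tendsto hlim (Eventually.of_forall Subtype.prop),
    fun _ hk => le_csSup hbdd hk⟩

/-
The coordinates in `A` are the unbounded ones; finitely many elements of `P` that are large in one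
coordinate each have a supremum that is large in all of them.
-/
theorem exists_finset_forall_exists_lt_of_not_bddAbove {F : Type*} [Finite F] {P : Set (F → ℝ)}
    (hP : SupClosed P) (hbdd : ¬ BddAbove P) :
    ∃ A : Finset F, A.Nonempty ∧ ∃ D, ∀ R, ∃ k ∈ P, (∀ i ∈ A, R < k i) ∧ ∀ i ∉ A, k i ≤ D := by
  classical
  have := Fintype.ofFinite F
  set A : Finset F := Finset.univ.filter fun i => ¬ BddAbove (Function.eval i '' P)
  have hA : ∀ {i}, i ∈ A ↔ ¬ BddAbove (Function.eval i '' P) := by simp [A]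
  have hAne : A.Nonempty := by
    rw [bddAbove_pi, not_forall] at hbdd
    exact hbdd.imp fun _ => hA.2
  have hbound : ∀ i ∉ A, ∃ C, ∀ k ∈ P, k i ≤ C := fun i hi => by
    obtain ⟨C, hC⟩ := not_not.1 (mt hA.2 hi)
    exact ⟨C, fun k hk => hC (mem_image_of_mem _ hk)⟩
  choose! C hC using hbound
  obtain ⟨D, hD⟩ := (finite_range C).bddAbove
  refine ⟨A, hAne, D, fun R => ?_⟩
  have hlarge : ∀ i ∈ A, ∃ k ∈ P, R < k i := fun i hi => by
    obtain ⟨_, ⟨k, hk, rfl⟩, hlt⟩ := not_bddAbove_iff.1 (hA.1 hi) R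
    exact ⟨k, hk, hlt⟩
  choose! k hk hlt using hlarge
  refine ⟨A.sup' hAne k, hP.finsetSup'_mem hAne hk, fun i hi => ?_, fun i hi => ?_⟩
  · exact (hlt i hi).trans_le (Finset.le_sup' k hi i)
  · exact (hC i hi _ (hP.finsetSup'_mem hAne hk)).trans (hD (mem_range_self i))

theorem nontrivial_of_nonempty_of_ne_univ {α : Type*} [Fintype α] {s : Finset α}
    (hs : s.Nonempty) (hs' : s ≠ Finset.univ) : Nontrivial α := by
  obtain ⟨a, ha⟩ := hs
  obtain ⟨b, hb⟩ := not_forall.1 (mt Finset.eq_univ_iff_forall.2 hs')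
  exact ⟨a, b, ne_of_mem_of_not_mem ha hb⟩

theorem exists_pos_forall_le_of_finite {ι : Type*} [Finite ι] {f : ι → ℝ} (hf : ∀ i, 0 < f i) :
    ∃ c > 0, ∀ i, c ≤ f i := by
  rcases isEmpty_or_nonempty ι with h | h
  · exact ⟨1, one_pos, fun i => h.elim i⟩
  · obtain ⟨i, hi⟩ := Finite.exists_min f
    exact ⟨f i, hf i, hi⟩

section IntegralCurve

variable {X : Type*} [NormedAddCommGroup X] [NormedSpace ℝ X] {v : X → X} {K M : NNReal}

theorem exists_forall_mem_Ioo_hasDerivAt_of_lipschitzWith [CompleteSpace X] (hv : LipschitzWith K v)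
    (hM : ∀ x, ‖v x‖ ≤ M) (x₀ : X) (r : NNReal) :
    ∃ α : ℝ → X, α 0 = x₀ ∧ ∀ t ∈ Ioo (-r : ℝ) r, HasDerivAt α (v (α t)) t := by
  have h0 : (0 : ℝ) ∈ Icc (-r : ℝ) r := ⟨neg_nonpos.2 r.coe_nonneg, r.coe_nonneg⟩
  have hPL : IsPicardLindelof (fun _ => v) (⟨0, h0⟩ : Icc (-r : ℝ) r) x₀ (M * r) 0 M K :=
    IsPicardLindelof.of_time_independent (fun x _ => hM x) hv.lipschitzOnWith (by simp)
  obtain ⟨α, hα, hα'⟩ := hPL.exists_eq_forall_mem_Icc_hasDerivWithinAt₀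
  exact ⟨α, hα, fun t ht => (hα' t (Ioo_subset_Icc_self ht)).hasDerivAt (Icc_mem_nhds ht.1 ht.2)⟩

theorem exists_forall_hasDerivAt_of_forall_mem_Ioo (hv : LipschitzWith K v) {x₀ : X}
    (hlocal : ∀ n : ℕ, ∃ α : ℝ → X, α 0 = x₀ ∧ ∀ t ∈ Ioo (-n : ℝ) n, HasDerivAt α (v (α t)) t) :
    ∃ α : ℝ → X, α 0 = x₀ ∧ ∀ t, HasDerivAt α (v (α t)) t := by
  choose α hα hα' using hlocal
  have hagree : ∀ {n m : ℕ} {t : ℝ}, |t| < n → n ≤ m → α n t = α m t := fun {n m t} ht hnm => by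
    have hsub : Ioo (-n : ℝ) n ⊆ Ioo (-m : ℝ) m := by gcongr
    exact ODE_solution_unique_of_mem_Ioo (v := fun _ => v) (s := fun _ => univ) (t₀ := 0)
      (fun t _ => hv.lipschitzOnWith) (abs_lt.1 ((abs_zero.trans_le (abs_nonneg t)).trans_lt ht))
      (fun t ht => ⟨hα' n t ht, mem_univ _⟩) (fun t ht => ⟨hα' m t (hsub ht), mem_univ _⟩)
      ((hα n).trans (hα m).symm) (abs_lt.1 ht)
  have hceil : ∀ t : ℝ, |t| < (⌊|t|⌋₊ + 1 : ℕ) := fun t => by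
    exact_mod_cast Nat.lt_floor_add_one |t|
  refine ⟨fun t => α (⌊|t|⌋₊ + 1) t, hα _, fun t => ?_⟩
  obtain ⟨N, hN⟩ := exists_nat_gt (|t| + 1)
  have hglue : (fun x => α (⌊|x|⌋₊ + 1) x) =ᶠ[𝓝 t] α N := by
    filter_upwards [(continuous_abs.tendsto t).eventually_lt_const (lt_add_one |t|)] with x hx
    exact hagree (hceil x) (Nat.succ_le_of_lt ((Nat.floor_lt (abs_nonneg x)).2 (hx.trans hN)))
  have hderiv := hα' N t (abs_lt.1 ((lt_add_one |t|).trans hN))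
  rw [← hglue.eq_of_nhds] at hderiv
  exact hderiv.congr_of_eventuallyEq hglue

theorem exists_forall_hasDerivAt_of_lipschitzWith [CompleteSpace X] (hv : LipschitzWith K v)
    (hM : ∀ x, ‖v x‖ ≤ M) (x₀ : X) :
    ∃ α : ℝ → X, α 0 = x₀ ∧ ∀ t, HasDerivAt α (v (α t)) t :=
  exists_forall_hasDerivAt_of_forall_mem_Ioo hv fun n =>
    exists_forall_mem_Ioo_hasDerivAt_of_lipschitzWith hv hM x₀ n

end IntegralCurve

section Barrier

variable {ι : Type*} [Finite ι] {u u' : ℝ → ι → ℝ}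

theorem forall_le_of_deriv_lt_of_eq {B B' : ℝ → ℝ}
    (hu : ∀ t, 0 ≤ t → ∀ i, HasDerivAt (fun s => u s i) (u' t i) t)
    (hB : ∀ t, 0 ≤ t → HasDerivAt B (B' t) t) (h0 : ∀ i, u 0 i ≤ B 0)
    (hcross : ∀ t, 0 ≤ t → ∀ i, (∀ j, u t j ≤ B t) → u t i = B t → u' t i < B' t)
    {t : ℝ} (ht : 0 ≤ t) (i : ι) : u t i ≤ B t := by
  set s : Set ℝ := {x | ∀ j, u x j ≤ B x}
  have hclosed : IsClosed (s ∩ Icc 0 t) := by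
    have hcont : ContinuousOn u (Icc 0 t) := continuousOn_pi.2 fun j x hx =>
      (hu x hx.1 j).continuousAt.continuousWithinAt
    have hcontB : ContinuousOn (fun x (_ : ι) => B x) (Icc 0 t) := continuousOn_pi.2 fun _ x hx =>
      (hB x hx.1).continuousAt.continuousWithinAt
    exact inter_comm (Icc 0 t) s ▸ isClosed_Icc.isClosed_le hcont hcontB
  refine hclosed.Icc_subset_of_forall_mem_nhdsWithin h0 (fun x hx => ?_) (right_mem_Icc.2 ht) i
  refine eventually_all.2 fun j => ?_
  have hderiv := (hu x hx.2.1 j).sub (hB x hx.2.1)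
  rcases (hx.1 j).lt_or_eq with hlt | heq
  · filter_upwards [nhdsWithin_le_nhds (hderiv.continuousAt.eventually_lt_const (sub_neg.2 hlt))]
      with y hy using (sub_neg.1 hy).le
  · have hslope := hderiv.hasDerivWithinAt.limsup_slope_le' (s := Ioi x) self_notMem_Ioi
      (sub_neg.2 (hcross x hx.2.1 j hx.1 heq))
    filter_upwards [hslope, self_mem_nhdsWithin] with y hy hxy
    have hneg : u y j - B y < u x j - B x := (slope_neg_iff_of_le (le_of_lt hxy)).1 hy
    linarith

theorem eventually_lt_of_deriv_le_neg {c : ℝ} (hc : 0 < c)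
    (hu : ∀ t, 0 ≤ t → ∀ i, HasDerivAt (fun s => u s i) (u' t i) t)
    (hmax : ∀ t, 0 ≤ t → ∀ i, (∀ j, u t j ≤ u t i) → 0 ≤ u t i → u' t i ≤ -c)
    {η : ℝ} (hη : 0 < η) : ∀ᶠ t in atTop, ∀ i, u t i < η := by
  obtain ⟨D, hD⟩ := (finite_range (u 0)).bddAbove
  set A := max D 1
  have hA : 0 < A := one_pos.trans_le (le_max_right _ _)
  set δ := c / (2 * A)
  have hδ : 0 < δ := by positivity
  have hB : ∀ t, HasDerivAt (fun t => A * Real.exp (-δ * t)) (-(c / 2) * Real.exp (-δ * t)) t :=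
    fun t => ((((hasDerivAt_id t).const_mul (-δ)).exp).const_mul A).congr_deriv (by
      simp only [δ, id]
      field_simp)
  have hbarrier : ∀ t, 0 ≤ t → ∀ i, u t i ≤ A * Real.exp (-δ * t) := fun t ht i => by
    refine forall_le_of_deriv_lt_of_eq hu (fun t _ => hB t) (fun j => ?_) ?_ ht i
    · rw [mul_zero, Real.exp_zero, mul_one]
      exact (hD (mem_range_self j)).trans (le_max_left _ _)
    · intro s hs j hj heq
      have hdecay := hmax s hs j (heq ▸ hj) (heq ▸ by positivity)
      have hexp : Real.exp (-δ * s) ≤ 1 := Real.exp_le_one_iff.2 (by nlinarith)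
      nlinarith
  have hlim : Tendsto (fun t => A * Real.exp (-δ * t)) atTop (𝓝 0) := by
    have hexp := Real.tendsto_exp_atBot.comp
      (tendsto_id.const_mul_atTop_of_neg (r := -δ) (by linarith))
    exact mul_zero A ▸ hexp.const_mul A
  filter_upwards [hlim.eventually_lt_const hη, eventually_ge_atTop 0] with t ht h0 i
  exact (hbarrier t h0 i).trans_lt ht

end Barrier

theorem exists_isOpen_isPreconnected_diff_singleton {E X : Type*} [NormedAddCommGroup E]
    [NormedSpace ℝ E] [TopologicalSpace X] [ChartedSpace E X] (h : 1 < Module.rank ℝ E)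
    {x : X} {W : Set X} (hW : W ∈ 𝓝 x) :
    ∃ V ⊆ W, IsOpen V ∧ x ∈ V ∧ IsPreconnected (V \ {x}) := by
  set φ := chartAt E x
  have hxs : x ∈ φ.source := mem_chart_source E x
  have hW' : φ.target ∩ φ.symm ⁻¹' W ∈ 𝓝 (φ x) :=
    inter_mem (φ.open_target.mem_nhds (φ.map_source hxs))
      (φ.continuousAt_symm (φ.map_source hxs) (by rwa [φ.left_inv hxs]))
  obtain ⟨r, hr, hball⟩ := Metric.mem_nhds_iff.1 hW'
  set β := OpenPartialHomeomorph.univBall (φ x) r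
  have hβ : ∀ y, β y ∈ Metric.ball (φ x) r := fun y => by
    have hy := β.map_source (x := y) (by simp [β])
    rwa [OpenPartialHomeomorph.univBall_target _ hr] at hy
  have hψ : IsOpenEmbedding (β.trans φ.symm) :=
    (β.trans φ.symm).isOpenEmbedding <| eq_univ_of_forall fun y => by
      simp [β, (hball (hβ y)).1]
  have hψ0 : β.trans φ.symm 0 = x := by simp [β, hxs]
  refine ⟨range (β.trans φ.symm), range_subset_iff.2 fun y => (hball (hβ y)).2,
    hψ.isOpen_range, ⟨0, hψ0⟩, ?_⟩
  rw [← image_univ, ← hψ0, ← image_singleton, ← image_sdiff hψ.injective, ← compl_eq_univ_sdiff]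
  exact (isConnected_compl_singleton_of_one_lt_rank h 0).isPreconnected.image _
    hψ.continuous.continuousOn

theorem isOpen_closure_of_finite_frontier {E X : Type*} [NormedAddCommGroup E]
    [NormedSpace ℝ E] [TopologicalSpace X] [T1Space X] [ChartedSpace E X]
    (h : 1 < Module.rank ℝ E) {U : Set X} (hU : IsOpen U) (hfin : (frontier U).Finite) :
    IsOpen (closure U) := by
  refine isOpen_iff_mem_nhds.2 fun x hx => ?_
  by_cases hxU : x ∈ U
  · exact mem_of_superset (hU.mem_nhds hxU) subset_closure
  have hW : (frontier U \ {x})ᶜ ∈ 𝓝 x :=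
    (hfin.subset sdiff_subset).isClosed.isOpen_compl.mem_nhds (by simp)
  obtain ⟨V, hVW, hV, hxV, hconn⟩ := exists_isOpen_isPreconnected_diff_singleton h hW
  have hcover : V \ {x} ⊆ U ∪ (closure U)ᶜ := fun y hy => by
    by_contra! hyU
    simp only [mem_union, mem_compl_iff, not_or, not_not] at hyU
    exact hVW hy.1 ⟨hU.frontier_eq ▸ ⟨hyU.2, hyU.1⟩, hy.2⟩
  have hmeet : (V \ {x} ∩ U).Nonempty := by
    obtain ⟨y, hyV, hyU⟩ := mem_closure_iff.1 hx V hV hxV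
    exact ⟨y, ⟨hyV, fun hyx => hxU (hyx ▸ hyU)⟩, hyU⟩
  have hVU : V \ {x} ⊆ U :=
    hconn.subset_left_of_subset_union hU isClosed_closure.isOpen_compl
      (disjoint_compl_right.mono_left subset_closure) hcover hmeet
  refine mem_of_superset (hV.mem_nhds hxV) fun y hy => ?_
  by_cases hyx : y = x
  · exact hyx ▸ hx
  · exact subset_closure (hVU ⟨hy, hyx⟩)

namespace CirclePattern

section Surface

variable {S : Type*} [TopologicalSpace S] [CWComplex (univ : Set S)]

theorem disjoint_openCell_cellFrontier {n m : ℕ} (hnm : n ≤ m)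
    (i : RelCWComplex.cell (univ : Set S) m) (j : RelCWComplex.cell (univ : Set S) n) :
    Disjoint (RelCWComplex.openCell m i) (RelCWComplex.cellFrontier n j) := by
  obtain ⟨J, hJ⟩ := CWComplex.cellFrontier_subset_finite_openCell (C := (univ : Set S)) n j
  refine Disjoint.mono_right hJ ?_
  simp only [disjoint_iUnion_right]
  intro l hl q _
  refine RelCWComplex.disjoint_openCell_of_ne fun h => ?_
  have hml : m = l := congrArg Sigma.fst h
  omega

theorem isOpen_openCell_of_top [T2Space S] {m : ℕ}
    (hdim : ∀ n, m < n → IsEmpty (RelCWComplex.cell (univ : Set S) n))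
    (i : RelCWComplex.cell (univ : Set S) m) : IsOpen (RelCWComplex.openCell m i) := by
  rw [← isClosed_compl_iff]
  refine CWComplex.isClosed_of_disjoint_openCell_or_isClosed_inter_closedCell
    (C := (univ : Set S)) (subset_univ _) fun n _ j => ?_
  have hnm : n ≤ m := not_lt.1 fun h => (hdim n h).false j
  by_cases hij : (⟨m, i⟩ : Σ n, RelCWComplex.cell (univ : Set S) n) = ⟨n, j⟩
  · cases hij
    exact Or.inl disjoint_compl_left
  · right
    rw [inter_eq_right.2]
    · exact RelCWComplex.isClosed_closedCell
    · rw [← RelCWComplex.cellFrontier_union_openCell_eq_closedCell, subset_compl_iff_disjoint_left]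
      exact (disjoint_openCell_cellFrontier hnm i j).union_right
        (RelCWComplex.disjoint_openCell_of_ne hij)

theorem LieOnTwoSides.exists_isOpen {e : Edges S} {f₁ f₂ : Faces S} (h : LieOnTwoSides e f₁ f₂) :
    ∃ V, IsOpen V ∧ RelCWComplex.openCell 1 e ⊆ V ∧
      V ⊆ RelCWComplex.openCell 1 e ∪
        (RelCWComplex.openCell 2 f₁ ∪ RelCWComplex.openCell 2 f₂) := by
  obtain ⟨ψ, hψ, h0, h1, h2⟩ := h
  refine ⟨range ψ, hψ.isOpen_range, h0 ▸ image_subset_range _ _, ?_⟩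
  rintro _ ⟨z, rfl⟩
  rcases lt_trichotomy z.2 0 with hz | hz | hz
  · exact Or.inr (Or.inr (h2 ⟨z, hz, rfl⟩))
  · exact Or.inl (h0 ▸ mem_image_of_mem ψ hz)
  · exact Or.inr (Or.inl (h1 ⟨z, hz, rfl⟩))

variable [T2Space S] {f₁ f₂ : Edges S → Faces S}

theorem frontier_openCell_subset_of_forall_ne
    (hdim : ∀ n, 2 < n → IsEmpty (RelCWComplex.cell (univ : Set S) n))
    (hsides : ∀ e, LieOnTwoSides e (f₁ e) (f₂ e)) {i : Faces S}
    (hi : ∀ e, f₁ e ≠ i ∧ f₂ e ≠ i) :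
    frontier (RelCWComplex.openCell 2 i) ⊆
      ⋃ v : RelCWComplex.cell (univ : Set S) 0, RelCWComplex.openCell 0 v := by
  intro x hx
  have hdisj : ∀ n (q : RelCWComplex.cell (univ : Set S) n),
      (⟨2, i⟩ : Σ n, RelCWComplex.cell (univ : Set S) n) ≠ ⟨n, q⟩ →
      Disjoint (RelCWComplex.openCell 2 i) (RelCWComplex.openCell n q) := fun n q h =>
    RelCWComplex.disjoint_openCell_of_ne h
  have hmeet : ∀ V, IsOpen V → x ∈ V → ¬Disjoint (RelCWComplex.openCell 2 i) V := fun V hV hxV =>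
    not_disjoint_iff_nonempty_inter.2
      (inter_comm V _ ▸ mem_closure_iff.1 (frontier_subset_closure hx) V hV hxV)
  obtain ⟨n, q, hxq⟩ : ∃ n, ∃ q : RelCWComplex.cell (univ : Set S) n,
      x ∈ RelCWComplex.openCell n q := by
    simpa only [mem_iUnion] using
      (CWComplex.iUnion_openCell_eq_complex (C := (univ : Set S))).ge (mem_univ x)
  have hn : n ≤ 2 := not_lt.1 fun h => (hdim n h).false q
  interval_cases n
  · exact mem_iUnion.2 ⟨q, hxq⟩
  · obtain ⟨V, hV, hqV, hVsub⟩ := (hsides q).exists_isOpen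
    refine absurd (Disjoint.mono_right hVsub ?_) (hmeet V hV (hqV hxq))
    simp only [disjoint_union_right]
    exact ⟨hdisj 1 q (by simp), hdisj 2 _ (by simpa using (hi q).1.symm),
      hdisj 2 _ (by simpa using (hi q).2.symm)⟩
  · by_cases hqi : q = i
    · have hxi : x ∉ RelCWComplex.openCell 2 i := by
        rw [(isOpen_openCell_of_top hdim i).frontier_eq] at hx
        exact hx.2
      exact absurd (hqi ▸ hxq) hxi
    · exact absurd (hdisj 2 q (by simpa using Ne.symm hqi))
        (hmeet _ (isOpen_openCell_of_top hdim q) hxq)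

theorem exists_edge_of_face [ConnectedSpace S] [ChartedSpace (EuclideanSpace ℝ (Fin 2)) S]
    [Finite (RelCWComplex.cell (univ : Set S) 0)] [Nontrivial (Faces S)]
    (hdim : ∀ n, 2 < n → IsEmpty (RelCWComplex.cell (univ : Set S) n))
    (hsides : ∀ e, LieOnTwoSides e (f₁ e) (f₂ e)) (i : Faces S) : ∃ e, f₁ e = i ∨ f₂ e = i := by
  by_contra! hi
  have hopen := isOpen_openCell_of_top hdim i
  have hfin : (frontier (RelCWComplex.openCell 2 i)).Finite := by
    refine (finite_iUnion fun v => ?_).subset (frontier_openCell_subset_of_forall_ne hdim hsides hi)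
    rw [RelCWComplex.openCell_zero_eq_singleton]
    exact finite_singleton _
  have hrank : 1 < Module.rank ℝ (EuclideanSpace ℝ (Fin 2)) := by
    rw [← Module.finrank_eq_rank, finrank_euclideanSpace_fin]
    exact_mod_cast one_lt_two
  have hclopen : IsClopen (closure (RelCWComplex.openCell 2 i)) :=
    ⟨isClosed_closure, isOpen_closure_of_finite_frontier hrank hopen hfin⟩
  have huniv := hclopen.eq_univ (RelCWComplex.openCell_nonempty 2 i).closure
  obtain ⟨j, hji⟩ := exists_ne i
  have hd : Disjoint (closure (RelCWComplex.openCell 2 i)) (RelCWComplex.openCell 2 j) :=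
    (RelCWComplex.disjoint_openCell_of_ne (by simpa using hji.symm)).closure_left
      (isOpen_openCell_of_top hdim j)
  rw [huniv, univ_disjoint] at hd
  exact (RelCWComplex.openCell_nonempty 2 j).ne_empty hd

end Surface

/-- The inverse cotangent with values in `(0, π)`, for the angles as well as for the radii
`radius k`. -/
noncomputable def arccot (x : ℝ) : ℝ := Real.pi / 2 - Real.arctan x

theorem arccot_mem_Ioo (x : ℝ) : arccot x ∈ Ioo 0 Real.pi := by
  have hx := Real.arctan_mem_Ioo x
  unfold arccot
  constructor <;> linarith [hx.1, hx.2]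

theorem arccot_le_pi_div_two {x : ℝ} (hx : 0 ≤ x) : arccot x ≤ Real.pi / 2 :=
  sub_le_self _ (Real.arctan_nonneg.2 hx)

theorem arccot_eq_arctan_inv {x : ℝ} (hx : 0 < x) : arccot x = Real.arctan x⁻¹ :=
  (Real.arctan_inv_of_pos hx).symm

theorem continuous_arccot : Continuous arccot :=
  continuous_const.sub Real.continuous_arctan

theorem strictAnti_arccot : StrictAnti arccot := fun _ _ h =>
  sub_lt_sub_left (Real.arctan_strictMono h) _

theorem sin_arccot (x : ℝ) : Real.sin (arccot x) = 1 / √(1 + x ^ 2) := by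
  rw [arccot, Real.sin_pi_div_two_sub, Real.cos_arctan]

theorem cos_arccot (x : ℝ) : Real.cos (arccot x) = x * Real.sin (arccot x) := by
  rw [sin_arccot, arccot, Real.cos_pi_div_two_sub, Real.sin_arctan, mul_one_div]

theorem cot_arccot (x : ℝ) : Real.cot (arccot x) = x := by
  rw [← Real.tan_inv_eq_cot, arccot, Real.tan_pi_div_two_sub, inv_inv, Real.tan_arctan]

theorem arccot_eq_of_cos_eq {x β : ℝ} (hβ : β ∈ Ioo 0 Real.pi)
    (h : Real.cos β = x * Real.sin β) : arccot x = β := by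
  have hx : x = Real.tan (Real.pi / 2 - β) := by
    rw [Real.tan_pi_div_two_sub, Real.tan_eq_sin_div_cos, inv_div, h,
      mul_div_cancel_right₀ _ (Real.sin_pos_of_mem_Ioo hβ).ne']
  rw [arccot, hx, Real.arctan_tan (by linarith [hβ.2]) (by linarith [hβ.1]), sub_sub_cancel]

theorem cos_arccot_nonneg {x : ℝ} (hx : 0 ≤ x) : 0 ≤ Real.cos (arccot x) := by
  rw [cos_arccot]
  exact mul_nonneg hx (Real.sin_pos_of_mem_Ioo (arccot_mem_Ioo x)).le

theorem strictMono_cos_arccot : StrictMono fun x => Real.cos (arccot x) := fun x y h =>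
  Real.cos_lt_cos_of_nonneg_of_le_pi (arccot_mem_Ioo y).1.le (arccot_mem_Ioo x).2.le
    (strictAnti_arccot h)

theorem tendsto_cos_arccot_atTop : Tendsto (fun x => Real.cos (arccot x)) atTop (𝓝 1) := by
  have harccot : Tendsto arccot atTop (𝓝 (Real.pi / 2 - Real.pi / 2)) :=
    (Real.tendsto_arctan_atTop.mono_right nhdsWithin_le_nhds).const_sub _
  rw [sub_self] at harccot
  exact Real.cos_zero ▸ (Real.continuous_cos.tendsto 0).comp harccot

theorem div_one_add_sq_lt_arccot (x : ℝ) : x / (1 + x ^ 2) < arccot x := by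
  calc x / (1 + x ^ 2) = Real.sin (2 * arccot x) / 2 := by
        rw [Real.sin_two_mul, cos_arccot, arccot, Real.sin_pi_div_two_sub]
        linear_combination -x * Real.cos_sq_arctan x
    _ < arccot x := by
        linarith [Real.sin_lt (x := 2 * arccot x) (by linarith [(arccot_mem_Ioo x).1])]

theorem strictMono_mul_arccot_mul (y : ℝ) : StrictMono fun x => x * arccot (x * y) := by
  refine strictMono_of_deriv_pos fun x => ?_
  have hd : HasDerivAt (fun x => x * arccot (x * y))
      (1 * arccot (x * y) + x * -(1 / (1 + (x * y) ^ 2) * (1 * y))) x :=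
    (hasDerivAt_id x).mul ((((hasDerivAt_id x).mul_const y).arctan).const_sub _)
  rw [hd.deriv]
  have h := div_one_add_sq_lt_arccot (x * y)
  have heq : x * -(1 / (1 + (x * y) ^ 2) * (1 * y)) = -(x * y / (1 + (x * y) ^ 2)) := by ring
  linarith

theorem norm_fromPole (α r : ℝ) : ‖fromPole α r‖ = 1 := by
  rw [EuclideanSpace.norm_eq, Real.sqrt_eq_one]
  simp only [fromPole, Fin.sum_univ_three, Real.norm_eq_abs, sq_abs, PiLp.toLp_apply,
    Matrix.cons_val_zero, Matrix.cons_val_one, Matrix.cons_val]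
  linear_combination Real.sin_sq_add_cos_sq r + Real.sin r ^ 2 * Real.sin_sq_add_cos_sq α

theorem boundaryCircle_eq (r θ : ℝ) : boundaryCircle r θ =
    !₂[Real.cos r * Real.sin r * (1 - Real.cos θ), Real.sin r * Real.sin θ,
      Real.cos r ^ 2 + Real.sin r ^ 2 * Real.cos θ] := by
  ext j
  fin_cases j <;> simp [boundaryCircle, fromPole] <;> ring

theorem norm_boundaryCircle (r θ : ℝ) : ‖boundaryCircle r θ‖ = 1 := by
  rw [EuclideanSpace.norm_eq, Real.sqrt_eq_one, boundaryCircle_eq]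
  simp only [Fin.sum_univ_three, Real.norm_eq_abs, sq_abs, Matrix.cons_val_zero,
    Matrix.cons_val_one, Matrix.cons_val]
  linear_combination Real.sin r ^ 2 * Real.sin_sq_add_cos_sq θ +
    (Real.cos r ^ 2 + Real.sin r ^ 2 * Real.cos θ ^ 2 + 1) * Real.sin_sq_add_cos_sq r

theorem norm_deriv_boundaryCircle {r : ℝ} (hr : 0 ≤ Real.sin r) (θ : ℝ) :
    ‖deriv (boundaryCircle r) θ‖ = Real.sin r := by
  have hderiv : HasDerivAt (boundaryCircle r)
      (Real.sin r • (-Real.sin θ • !₂[-Real.cos r, 0, Real.sin r] +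
        Real.cos θ • !₂[0, 1, 0]) : EuclideanSpace ℝ (Fin 3)) θ :=
    ((((Real.hasDerivAt_cos θ).smul_const _).add ((Real.hasDerivAt_sin θ).smul_const _)).const_smul
      (Real.sin r)).const_add _
  have hunit : ‖(-Real.sin θ • !₂[-Real.cos r, 0, Real.sin r] +
      Real.cos θ • !₂[0, 1, 0] : EuclideanSpace ℝ (Fin 3))‖ = 1 := by
    rw [EuclideanSpace.norm_eq, Real.sqrt_eq_one]
    simp only [Fin.sum_univ_three, Real.norm_eq_abs, sq_abs, PiLp.add_apply, PiLp.smul_apply,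
      smul_eq_mul, Matrix.cons_val_zero, Matrix.cons_val_one, Matrix.cons_val]
    linear_combination Real.sin_sq_add_cos_sq θ + Real.sin θ ^ 2 * Real.sin_sq_add_cos_sq r
  rw [hderiv.deriv, norm_smul, Real.norm_of_nonneg hr, hunit, mul_one]

theorem mem_sphericalDisk_iff {c x : EuclideanSpace ℝ (Fin 3)} (hc : ‖c‖ = 1) (hx : ‖x‖ = 1)
    {r : ℝ} (h0 : 0 ≤ r) (hπ : r ≤ Real.pi) :
    x ∈ sphericalDisk c r ↔ Real.cos r < inner ℝ c x := by
  have hmem := Real.strictAntiOn_cos.lt_iff_gt ⟨h0, hπ⟩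
    ⟨InnerProductGeometry.angle_nonneg c x, InnerProductGeometry.angle_le_pi c x⟩
  rw [InnerProductGeometry.cos_angle, hc, hx, mul_one, div_one] at hmem
  simp only [sphericalDisk, mem_ofPred_eq, hx, true_and, hmem]

theorem inner_fromPole_boundaryCircle (φ r r' θ : ℝ) :
    inner ℝ (fromPole (Real.pi - φ) r') (boundaryCircle r θ) =
      Real.cos r' + Real.sin r * (Real.sin r' * (Real.sin φ * Real.sin θ) -
        (Real.cos r * Real.sin r' * Real.cos φ + Real.sin r * Real.cos r') * (1 - Real.cos θ)) := by
  rw [boundaryCircle_eq, PiLp.inner_apply]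
  simp only [fromPole, Fin.sum_univ_three, PiLp.toLp_apply, RCLike.inner_apply, conj_trivial,
    Matrix.cons_val_zero, Matrix.cons_val_one, Matrix.cons_val, Real.cos_pi_sub, Real.sin_pi_sub]
  linear_combination Real.cos r' * Real.sin_sq_add_cos_sq r

theorem sin_pos_of_mem {φ : ℝ} (hφ : φ ∈ Ioo 0 (Real.pi / 2)) : 0 < Real.sin φ :=
  Real.sin_pos_of_pos_of_lt_pi hφ.1 (by linarith [hφ.2, Real.pi_pos])

theorem cos_pos_of_mem {φ : ℝ} (hφ : φ ∈ Ioo 0 (Real.pi / 2)) : 0 < Real.cos φ :=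
  Real.cos_pos_of_mem_Ioo ⟨by linarith [hφ.1, Real.pi_pos], hφ.2⟩

theorem mul_one_sub_cos_lt_iff {a b θ : ℝ} (ha : 0 < a) (hb : 0 ≤ b)
    (hθ : θ ∈ Ioc (-Real.pi) Real.pi) :
    b * (1 - Real.cos θ) < a * Real.sin θ ↔ θ ∈ Ioo 0 (2 * arccot (b / a)) := by
  obtain ⟨x, rfl⟩ : ∃ x, θ = 2 * x := ⟨θ / 2, by ring⟩
  have hx1 : -(Real.pi / 2) < x := by linarith [hθ.1]
  have hx2 : x ≤ Real.pi / 2 := by linarith [hθ.2]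
  have hcos : 0 ≤ Real.cos x := Real.cos_nonneg_of_neg_pi_div_two_le_of_le hx1.le hx2
  have hhalf : a * Real.sin (2 * x) - b * (1 - Real.cos (2 * x)) =
      2 * (Real.sin x * (a * Real.cos x - b * Real.sin x)) := by
    rw [Real.cos_two_mul, Real.sin_two_mul, Real.cos_sq']
    ring
  rw [← sub_pos, hhalf, mul_pos_iff_of_pos_left two_pos]
  rcases le_or_gt x 0 with hx | hx
  · have hsin : Real.sin x ≤ 0 := Real.sin_nonpos_of_nonpos_of_neg_pi_le hx (by linarith)
    refine iff_of_false (not_lt.2 (mul_nonpos_of_nonpos_of_nonneg hsin ?_)) fun h => by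
      linarith [h.1]
    nlinarith [mul_nonneg ha.le hcos, mul_nonneg hb (neg_nonneg.2 hsin)]
  · have hsin : 0 < Real.sin x := Real.sin_pos_of_pos_of_lt_pi hx (by linarith)
    have hcot : arccot (Real.cos x / Real.sin x) = x :=
      arccot_eq_of_cos_eq ⟨hx, by linarith⟩ (by field_simp)
    rw [mul_pos_iff_of_pos_left hsin, sub_pos, mem_Ioo, and_iff_right (by linarith),
      mul_lt_mul_iff_right₀ two_pos]
    conv_rhs => rw [← hcot]
    rw [strictAnti_arccot.lt_iff_gt, div_lt_div_iff₀ ha hsin, mul_comm a]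

theorem boundaryCircle_mem_sphericalDisk_iff (φ θ : ℝ) {r r' : ℝ} (hr : r ∈ Ioo 0 Real.pi)
    (hr' : r' ∈ Ioo 0 Real.pi) :
    boundaryCircle r θ ∈ sphericalDisk (fromPole (Real.pi - φ) r') r' ↔
      (Real.cos r * Real.cos φ + Real.sin r * Real.cot r') * (1 - Real.cos θ) <
        Real.sin φ * Real.sin θ := by
  have hsr := Real.sin_pos_of_mem_Ioo hr
  have hsr' := Real.sin_pos_of_mem_Ioo hr'
  have hinner : inner ℝ (fromPole (Real.pi - φ) r') (boundaryCircle r θ) - Real.cos r' =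
      Real.sin r * Real.sin r' * (Real.sin φ * Real.sin θ -
        (Real.cos r * Real.cos φ + Real.sin r * Real.cot r') * (1 - Real.cos θ)) := by
    rw [inner_fromPole_boundaryCircle, Real.cot_eq_cos_div_sin]
    field_simp
    ring
  rw [mem_sphericalDisk_iff (norm_fromPole _ _) (norm_boundaryCircle _ _) hr'.1.le hr'.2.le,
    ← sub_pos, hinner, mul_pos_iff_of_pos_left (mul_pos hsr hsr'), sub_pos]

theorem bigonSideLength_eq {φ r r' : ℝ} (hφ : φ ∈ Ioo 0 (Real.pi / 2))
    (hr : r ∈ Ioc 0 (Real.pi / 2)) (hr' : r' ∈ Ioc 0 (Real.pi / 2)) :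
    bigonSideLength φ r r' = 2 * Real.sin r *
      arccot ((Real.cos r * Real.cos φ + Real.sin r * Real.cot r') / Real.sin φ) := by
  have hsφ := sin_pos_of_mem hφ
  have hcφ := cos_pos_of_mem hφ
  have hmem : ∀ {x}, x ∈ Ioc 0 (Real.pi / 2) → x ∈ Ioo 0 Real.pi := fun hx =>
    ⟨hx.1, by linarith [hx.2, Real.pi_pos]⟩
  have hsin : ∀ {x}, x ∈ Ioc 0 (Real.pi / 2) → 0 < Real.sin x := fun hx =>
    Real.sin_pos_of_mem_Ioo (hmem hx)
  have hcos : ∀ {x}, x ∈ Ioc 0 (Real.pi / 2) → 0 ≤ Real.cos x := fun hx =>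
    Real.cos_nonneg_of_neg_pi_div_two_le_of_le (by linarith [hx.1, Real.pi_pos]) hx.2
  set b := Real.cos r * Real.cos φ + Real.sin r * Real.cot r'
  have hb0 : 0 ≤ b := by
    have hcot : 0 ≤ Real.cot r' :=
      Real.cot_eq_cos_div_sin r' ▸ div_nonneg (hcos hr') (hsin hr').le
    exact add_nonneg (mul_nonneg (hcos hr) hcφ.le) (mul_nonneg (hsin hr).le hcot)
  have hpos := (arccot_mem_Ioo (b / Real.sin φ)).1
  have hle : arccot (b / Real.sin φ) ≤ Real.pi / 2 := arccot_le_pi_div_two (by positivity)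
  have harc : {θ | θ ∈ Ioc (-Real.pi) Real.pi ∧
      boundaryCircle r θ ∈ sphericalDisk (fromPole (Real.pi - φ) r') r'} =
      Ioo 0 (2 * arccot (b / Real.sin φ)) := by
    ext θ
    rw [mem_ofPred_eq, boundaryCircle_mem_sphericalDisk_iff φ θ (hmem hr) (hmem hr')]
    refine ⟨fun h => (mul_one_sub_cos_lt_iff hsφ hb0 h.1).1 h.2, fun h => ?_⟩
    have hθ : θ ∈ Ioc (-Real.pi) Real.pi := ⟨by linarith [h.1, Real.pi_pos], by linarith [h.2]⟩
    exact ⟨hθ, (mul_one_sub_cos_lt_iff hsφ hb0 hθ).2 h⟩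
  rw [bigonSideLength, harc]
  simp only [norm_deriv_boundaryCircle (hsin hr).le, setIntegral_const, smul_eq_mul,
    Real.volume_real_Ioo]
  rw [sub_zero, max_eq_left (by positivity)]
  ring

/-- Half the angle under which the side, on the circle of geodesic curvature `k`, of a bigon of
angle `φ` is seen from the centre of its disk. The other circle has geodesic curvature `k'`. -/
noncomputable def halfAngle (φ k k' : ℝ) : ℝ :=
  arccot (Real.sin (arccot k) * ((k * Real.cos φ + k') / Real.sin φ))

/-- The half angle `halfAngle` of the corresponding bigon in the Euclidean plane, between circles of
radii `1 / k` and `1 / k'`. -/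
noncomputable def flatAngle (φ k k' : ℝ) : ℝ :=
  arccot ((Real.cos φ + k' / k) / Real.sin φ)

section BigonSide

variable {φ k k' : ℝ}

theorem sideCurvature_eq (hφ : φ ∈ Ioo 0 (Real.pi / 2)) (hk : 0 ≤ k) (hk' : 0 ≤ k') :
    sideCurvature φ k k' = 2 * Real.cos (arccot k) * halfAngle φ k k' := by
  have hradius : ∀ x, radius x = arccot x := fun _ => rfl
  have hmem : ∀ {x : ℝ}, 0 ≤ x → arccot x ∈ Ioc 0 (Real.pi / 2) := fun {x} hx =>
    ⟨(arccot_mem_Ioo x).1, arccot_le_pi_div_two hx⟩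
  have harg : Real.sin (arccot k) * ((k * Real.cos φ + k') / Real.sin φ) =
      (Real.cos (arccot k) * Real.cos φ + Real.sin (arccot k) * k') / Real.sin φ := by
    rw [cos_arccot]
    ring
  rw [sideCurvature, hradius, hradius, bigonSideLength_eq hφ (hmem hk) (hmem hk'), cot_arccot,
    ← harg, ← halfAngle, cos_arccot]
  ring

theorem halfAngle_pos (φ k k' : ℝ) : 0 < halfAngle φ k k' := (arccot_mem_Ioo _).1

theorem halfAngle_le_pi_div_two (hφ : φ ∈ Ioo 0 (Real.pi / 2)) (hk : 0 ≤ k) (hk' : 0 ≤ k') :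
    halfAngle φ k k' ≤ Real.pi / 2 := by
  have hsin := sin_pos_of_mem hφ
  have hcos := cos_pos_of_mem hφ
  have hsk := Real.sin_pos_of_mem_Ioo (arccot_mem_Ioo k)
  exact arccot_le_pi_div_two (by positivity)

theorem halfAngle_antitone (hφ : φ ∈ Ioo 0 (Real.pi / 2)) (k : ℝ) : Antitone (halfAngle φ k) := by
  intro k' l' h
  have hsin := sin_pos_of_mem hφ
  have hsk := Real.sin_pos_of_mem_Ioo (arccot_mem_Ioo k)
  refine strictAnti_arccot.antitone ?_
  gcongr

theorem halfAngle_eq (hk : k ≠ 0) : halfAngle φ k k' =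
    arccot (Real.cos (arccot k) * ((Real.cos φ + k' / k) / Real.sin φ)) := by
  rw [halfAngle, cos_arccot]
  congr 1
  field_simp

theorem sideCurvature_zero (φ k' : ℝ) : sideCurvature φ 0 k' = 0 := mul_zero _

theorem sideCurvature_le_pi (hφ : φ ∈ Ioo 0 (Real.pi / 2)) (hk : 0 ≤ k) (hk' : 0 ≤ k') :
    sideCurvature φ k k' ≤ Real.pi := by
  rw [sideCurvature_eq hφ hk hk']
  have hle := halfAngle_le_pi_div_two hφ hk hk'
  have hpos := halfAngle_pos φ k k'
  nlinarith [Real.cos_le_one (arccot k)]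

theorem sideCurvature_antitoneOn (hφ : φ ∈ Ioo 0 (Real.pi / 2)) (hk : 0 ≤ k) :
    AntitoneOn (sideCurvature φ k) (Ici 0) := by
  intro k' hk' l' hl' h
  rw [sideCurvature_eq hφ hk hk', sideCurvature_eq hφ hk hl']
  exact mul_le_mul_of_nonneg_left (halfAngle_antitone hφ k h)
    (mul_nonneg zero_le_two (cos_arccot_nonneg hk))

theorem continuousOn_sideCurvature (hφ : φ ∈ Ioo 0 (Real.pi / 2)) :
    ContinuousOn (fun p : ℝ × ℝ => sideCurvature φ p.1 p.2) (Ici 0) := by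
  have hangle : Continuous fun p : ℝ × ℝ => halfAngle φ p.1 p.2 := by
    unfold halfAngle
    have := continuous_arccot
    fun_prop
  have hcos : Continuous fun p : ℝ × ℝ => 2 * Real.cos (arccot p.1) := by
    have := continuous_arccot
    fun_prop
  exact (hcos.mul hangle).continuousOn.congr fun p hp => sideCurvature_eq hφ hp.1 hp.2

/-
With `x = cos r`, the half angle is `arccot (x * y)` where `y` is invariant under scaling, and
`x * arccot (x * y)` increases with `x`.
-/
theorem sideCurvature_lt_mul (hφ : φ ∈ Ioo 0 (Real.pi / 2)) (hk : 0 < k) (hk' : 0 ≤ k') {c : ℝ}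
    (hc : 1 < c) : sideCurvature φ k k' < sideCurvature φ (c * k) (c * k') := by
  have hc0 : 0 < c := one_pos.trans hc
  rw [sideCurvature_eq hφ hk.le hk', sideCurvature_eq hφ (by positivity) (by positivity),
    halfAngle_eq hk.ne', halfAngle_eq (by positivity), mul_div_mul_left _ _ hc0.ne',
    mul_assoc, mul_assoc]
  exact mul_lt_mul_of_pos_left
    (strictMono_mul_arccot_mul _ (strictMono_cos_arccot (lt_mul_of_one_lt_left hk hc))) two_pos

theorem flatAngle_le_halfAngle (hφ : φ ∈ Ioo 0 (Real.pi / 2)) (hk : 0 < k) (hk' : 0 ≤ k') :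
    flatAngle φ k k' ≤ halfAngle φ k k' := by
  have hsin := sin_pos_of_mem hφ
  have hcos := cos_pos_of_mem hφ
  rw [halfAngle_eq hk.ne']
  exact strictAnti_arccot.antitone (mul_le_of_le_one_left (by positivity) (Real.cos_le_one _))

theorem mul_flatAngle_le_sideCurvature (hφ : φ ∈ Ioo 0 (Real.pi / 2)) {R : ℝ} (hR : R ≤ k)
    (hk : 0 < k) (hk' : 0 ≤ k') :
    2 * Real.cos (arccot R) * flatAngle φ k k' ≤ sideCurvature φ k k' := by
  rw [sideCurvature_eq hφ hk.le hk']
  have hcos := cos_arccot_nonneg hk.le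
  have hflat := flatAngle_le_halfAngle hφ hk hk'
  have hpos : 0 ≤ flatAngle φ k k' := (arccot_mem_Ioo _).1.le
  have hmono : Real.cos (arccot R) ≤ Real.cos (arccot k) := strictMono_cos_arccot.monotone hR
  gcongr

theorem flatAngle_lt (hφ : φ ∈ Ioo 0 (Real.pi / 2)) (hk : 0 < k) (hk' : 0 < k') :
    flatAngle φ k k' < φ := by
  have hsin := sin_pos_of_mem hφ
  calc flatAngle φ k k' < arccot (Real.cos φ / Real.sin φ) := by
        refine strictAnti_arccot ?_
        have hratio : 0 < k' / k := by positivity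
        gcongr
        linarith
    _ = φ := arccot_eq_of_cos_eq ⟨hφ.1, by linarith [hφ.2, Real.pi_pos]⟩ (by field_simp)

theorem flatAngle_add_flatAngle (hφ : φ ∈ Ioo 0 (Real.pi / 2)) (hk : 0 < k) (hk' : 0 < k') :
    flatAngle φ k k' + flatAngle φ k' k = φ := by
  have hsin := sin_pos_of_mem hφ
  have hlt := flatAngle_lt hφ hk hk'
  have hpos : 0 < flatAngle φ k k' := (arccot_mem_Ioo _).1
  suffices h : flatAngle φ k' k = φ - flatAngle φ k k' by rw [h, add_sub_cancel]
  refine arccot_eq_of_cos_eq ⟨by linarith, by linarith [hφ.2, Real.pi_pos]⟩ ?_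
  have hcos : Real.cos (flatAngle φ k k') =
      (Real.cos φ + k' / k) / Real.sin φ * Real.sin (flatAngle φ k k') := cos_arccot _
  rw [Real.cos_sub, Real.sin_sub, hcos]
  field_simp
  linear_combination Real.sin (flatAngle φ k k') * k * k' * Real.sin_sq_add_cos_sq φ

theorem flatAngle_le_flatAngle (hφ : φ ∈ Ioo 0 (Real.pi / 2)) {R C : ℝ} (hR : 0 < R) (hRk : R ≤ k)
    (hk' : 0 ≤ k') (hC : k' ≤ C) : flatAngle φ R C ≤ flatAngle φ k k' := by
  have hsin := sin_pos_of_mem hφ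
  have hC0 : 0 ≤ C := hk'.trans hC
  have : 0 < k := hR.trans_le hRk
  refine strictAnti_arccot.antitone ?_
  gcongr

theorem tendsto_flatAngle_atTop (hφ : φ ∈ Ioo 0 (Real.pi / 2)) (C : ℝ) :
    Tendsto (fun R => flatAngle φ R C) atTop (𝓝 φ) := by
  have hsin := sin_pos_of_mem hφ
  have hcot : arccot ((Real.cos φ + 0) / Real.sin φ) = φ :=
    arccot_eq_of_cos_eq ⟨hφ.1, by linarith [hφ.2, Real.pi_pos]⟩ (by field_simp; ring)
  have hlim : Tendsto (fun R : ℝ => (Real.cos φ + C / R) / Real.sin φ) atTop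
      (𝓝 ((Real.cos φ + 0) / Real.sin φ)) :=
    ((tendsto_const_nhds.div_atTop tendsto_id).const_add _).div_const _
  have hflat := (continuous_arccot.tendsto _).comp hlim
  rwa [hcot] at hflat

theorem mul_flatAngle_le_sideCurvature_of_le (hφ : φ ∈ Ioo 0 (Real.pi / 2)) {R D : ℝ} (hR : 0 < R)
    (hRk : R ≤ k) (hk' : 0 ≤ k') (hD : k' ≤ D) :
    2 * Real.cos (arccot R) * flatAngle φ R D ≤ sideCurvature φ k k' := by
  refine le_trans ?_ (mul_flatAngle_le_sideCurvature hφ hRk (hR.trans_le hRk) hk')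
  have hcos := cos_arccot_nonneg hR.le
  have hflat := flatAngle_le_flatAngle hφ hR hRk hk' hD
  gcongr

theorem mul_flatAngle_le_sideCurvature_add (hφ : φ ∈ Ioo 0 (Real.pi / 2)) {R D : ℝ} (hR : 0 < R)
    (hRk : R ≤ k) (hRk' : R ≤ k') (hD : 0 < D) :
    2 * Real.cos (arccot R) * flatAngle φ R D ≤ sideCurvature φ k k' + sideCurvature φ k' k := by
  have hk := hR.trans_le hRk
  have hk' := hR.trans_le hRk'
  calc 2 * Real.cos (arccot R) * flatAngle φ R D ≤ 2 * Real.cos (arccot R) * φ :=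
        mul_le_mul_of_nonneg_left (flatAngle_lt hφ hR hD).le
          (mul_nonneg zero_le_two (cos_arccot_nonneg hR.le))
    _ = 2 * Real.cos (arccot R) * flatAngle φ k k' +
        2 * Real.cos (arccot R) * flatAngle φ k' k := by
        rw [← mul_add, flatAngle_add_flatAngle hφ hk hk']
    _ ≤ sideCurvature φ k k' + sideCurvature φ k' k :=
        add_le_add (mul_flatAngle_le_sideCurvature hφ hRk hk hk'.le)
          (mul_flatAngle_le_sideCurvature hφ hRk' hk' hk.le)

theorem lipschitzWith_arctan_exp : LipschitzWith 1 fun x => Real.arctan (Real.exp x) := by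
  have hd : ∀ x, HasDerivAt (fun x => Real.arctan (Real.exp x))
    (1 / (1 + Real.exp x ^ 2) * Real.exp x) x := fun x => (Real.hasDerivAt_exp x).arctan
  refine lipschitzWith_of_nnnorm_deriv_le (fun x => (hd x).differentiableAt) fun x => ?_
  rw [(hd x).deriv, ← NNReal.coe_le_coe, coe_nnnorm, NNReal.coe_one,
    Real.norm_of_nonneg (by positivity), one_div_mul_eq_div, div_le_one (by positivity)]
  nlinarith [sq_nonneg (Real.exp x - 1), Real.exp_pos x]

theorem lipschitzWith_log_add_exp {a : ℝ} (ha : 0 ≤ a) :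
    LipschitzWith 1 fun x => Real.log (a + Real.exp x) := by
  have hd : ∀ x, HasDerivAt (fun x => Real.log (a + Real.exp x))
    (Real.exp x / (a + Real.exp x)) x :=
    fun x => ((Real.hasDerivAt_exp x).const_add a).log (by positivity)
  refine lipschitzWith_of_nnnorm_deriv_le (fun x => (hd x).differentiableAt) fun x => ?_
  rw [(hd x).deriv, ← NNReal.coe_le_coe, coe_nnnorm, NNReal.coe_one,
    Real.norm_of_nonneg (by positivity), div_le_one (by positivity)]
  linarith

theorem cos_arccot_exp (s : ℝ) :
    Real.cos (arccot (Real.exp s)) = Real.exp (-(Real.log (1 + Real.exp (-2 * s)) / 2)) := by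
  rw [arccot_eq_arctan_inv (Real.exp_pos s), Real.cos_arctan, ← Real.exp_neg, ← Real.exp_nat_mul,
    Real.exp_neg, Real.exp_half, Real.exp_log (by positivity), one_div]
  norm_num

theorem halfAngle_exp (hφ : φ ∈ Ioo 0 (Real.pi / 2)) (s s' : ℝ) :
    halfAngle φ (Real.exp s) (Real.exp s') =
      Real.arctan (Real.exp (Real.log (1 + Real.exp (-2 * s)) / 2 -
        Real.log (Real.cos φ + Real.exp (s' - s)) + Real.log (Real.sin φ))) := by
  have hsin := sin_pos_of_mem hφ
  have hcos := cos_pos_of_mem hφ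
  rw [halfAngle_eq (Real.exp_ne_zero s), cos_arccot_exp, ← Real.exp_sub,
    arccot_eq_arctan_inv (by positivity), Real.exp_add, Real.exp_sub (Real.log _ / 2),
    Real.exp_log hsin, Real.exp_log (add_pos hcos (Real.exp_pos _)), Real.exp_neg, mul_inv, inv_inv,
    inv_div]
  congr 1
  ring

theorem abs_halfAngle_exp_sub_le (hφ : φ ∈ Ioo 0 (Real.pi / 2)) {s s' t t' d : ℝ}
    (hd : |s - t| ≤ d) (hd' : |s' - t'| ≤ d) :
    |halfAngle φ (Real.exp s) (Real.exp s') - halfAngle φ (Real.exp t) (Real.exp t')| ≤ 3 * d := by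
  have h1 := (lipschitzWith_log_add_exp (cos_pos_of_mem hφ).le).dist_le_mul (s' - s) (t' - t)
  have h2 := (lipschitzWith_log_add_exp zero_le_one).dist_le_mul (-2 * s) (-2 * t)
  rw [halfAngle_exp hφ, halfAngle_exp hφ, ← Real.dist_eq]
  refine (lipschitzWith_arctan_exp.dist_le_mul _ _).trans ?_
  simp only [NNReal.coe_one, one_mul, Real.dist_eq] at h1 h2 ⊢
  have h3 : |s' - s - (t' - t)| ≤ 2 * d := by grind
  have h4 : |-2 * s - -2 * t| ≤ 2 * d := by grind
  have h5 := h1.trans h3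
  have h6 := h2.trans h4
  rw [abs_le] at h5 h6 ⊢
  constructor <;> linarith

theorem abs_cos_arccot_exp_sub_le (s t : ℝ) :
    |Real.cos (arccot (Real.exp s)) - Real.cos (arccot (Real.exp t))| ≤ |s - t| := by
  refine (Real.abs_cos_sub_cos_le _ _).trans ?_
  rw [arccot, arccot, sub_sub_sub_cancel_left, abs_sub_comm]
  simpa only [NNReal.coe_one, one_mul, Real.dist_eq] using lipschitzWith_arctan_exp.dist_le_mul s t

theorem abs_sideCurvature_exp_sub_le (hφ : φ ∈ Ioo 0 (Real.pi / 2)) {s s' t t' d : ℝ}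
    (hd : |s - t| ≤ d) (hd' : |s' - t'| ≤ d) :
    |sideCurvature φ (Real.exp s) (Real.exp s') - sideCurvature φ (Real.exp t) (Real.exp t')| ≤
      10 * d := by
  have hangle := abs_halfAngle_exp_sub_le hφ hd hd'
  have hcos := (abs_cos_arccot_exp_sub_le s t).trans hd
  have hcos_le := Real.abs_cos_le_one (arccot (Real.exp s))
  have hangle_le : |halfAngle φ (Real.exp t) (Real.exp t')| ≤ 2 := by
    rw [abs_of_pos (halfAngle_pos _ _ _)]
    linarith [halfAngle_le_pi_div_two hφ (Real.exp_pos t).le (Real.exp_pos t').le, Real.pi_le_four]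
  rw [sideCurvature_eq hφ (Real.exp_pos s).le (Real.exp_pos s').le,
    sideCurvature_eq hφ (Real.exp_pos t).le (Real.exp_pos t').le]
  set a := halfAngle φ (Real.exp s) (Real.exp s')
  set b := halfAngle φ (Real.exp t) (Real.exp t')
  set c := Real.cos (arccot (Real.exp s))
  set c' := Real.cos (arccot (Real.exp t))
  have hd0 : 0 ≤ d := (abs_nonneg _).trans hd
  calc |2 * c * a - 2 * c' * b| = 2 * |c * (a - b) + (c - c') * b| := by
        rw [← abs_two, ← abs_mul, abs_two]
        ring_nf
    _ ≤ 2 * (|c| * |a - b| + |c - c'| * |b|) := by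
        rw [← abs_mul, ← abs_mul]
        gcongr
        exact abs_add_le _ _
    _ ≤ 2 * (1 * (3 * d) + d * 2) := by gcongr
    _ = 10 * d := by ring

end BigonSide

/-! ### Maps with the monotonicity of the total geodesic curvatures -/

/-- The maps on nonnegative vectors that share the monotonicity of the total geodesic curvatures:
the `i`-th component decreases in the variables other than `k i`, and strictly increases along the
rays from the origin on which `k i` is positive. -/
structure IsCurvatureMap {F : Type*} (G : (F → ℝ) → F → ℝ) : Prop where
  continuousOn : ContinuousOn G (Ici 0)
  apply_eq_zero {k : F → ℝ} {i : F} : k i = 0 → G k i = 0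
  apply_le_apply {k l : F → ℝ} {i : F} : 0 ≤ k → k ≤ l → k i = l i → G l i ≤ G k i
  lt_apply_smul {k : F → ℝ} {i : F} {c : ℝ} : 0 ≤ k → 0 < k i → 1 < c → G k i < G (c • k) i

theorem nonneg_of_mem_stratum {F : Type*} {I : Finset F} {k : F → ℝ} (hk : k ∈ stratum I) :
    0 ≤ k := fun i => by
  by_cases hi : i ∈ I
  · exact (hk.1 i hi).le
  · exact (hk.2 i hi).ge

namespace IsCurvatureMap

variable {F : Type*} {G : (F → ℝ) → F → ℝ} {k l L : F → ℝ} {i : F} {I : Finset F}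

theorem tendsto_smul (hG : IsCurvatureMap G) (hk : 0 ≤ k) (i : F) :
    Tendsto (fun c : ℝ => G (c • k) i) (𝓝[>] 0) (𝓝 0) := by
  have hzero : G 0 i = 0 := hG.apply_eq_zero rfl
  have hsmul : Tendsto (fun c : ℝ => c • k) (𝓝[>] 0) (𝓝[Ici 0] 0) := by
    refine tendsto_nhdsWithin_iff.2 ⟨?_, ?_⟩
    · have hcont : Continuous fun c : ℝ => c • k := by fun_prop
      simpa only [zero_smul] using (hcont.tendsto 0).mono_left nhdsWithin_le_nhds
    · filter_upwards [self_mem_nhdsWithin] with c hc using smul_nonneg (le_of_lt hc) hk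
  have hlim := tendsto_pi_nhds.1 ((hG.continuousOn 0 self_mem_Ici).tendsto.comp hsmul) i
  rwa [hzero] at hlim

theorem pos (hG : IsCurvatureMap G) (hk : 0 ≤ k) (hi : 0 < k i) : 0 < G k i := by
  have hlt : ∀ {c d : ℝ}, 0 < c → c < d → G (c • k) i < G (d • k) i := fun {c d} hc hcd => by
    have h := hG.lt_apply_smul (smul_nonneg hc.le hk) (mul_pos hc hi) ((one_lt_div hc).2 hcd)
    rwa [smul_smul, div_mul_cancel₀ _ hc.ne'] at h
  have hhalf : 0 ≤ G ((2⁻¹ : ℝ) • k) i := by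
    refine le_of_tendsto (hG.tendsto_smul hk i) ?_
    filter_upwards [Ioo_mem_nhdsGT (show (0 : ℝ) < 2⁻¹ by norm_num)] with c hc
    exact (hlt hc.1 hc.2).le
  have h := hlt (by norm_num : (0 : ℝ) < 2⁻¹) (by norm_num : (2⁻¹ : ℝ) < 1)
  rw [one_smul] at h
  exact hhalf.trans_lt h

theorem pos_iff (hG : IsCurvatureMap G) (hk : 0 ≤ k) : 0 < G k i ↔ 0 < k i :=
  ⟨fun h => (hk i).lt_of_ne' fun hi => h.ne' (hG.apply_eq_zero hi), hG.pos hk⟩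

theorem apply_lt_of_le_smul (hG : IsCurvatureMap G) (hk : 0 ≤ k) (hl : 0 ≤ l) (hi : 0 < l i) {c : ℝ}
    (hc : 1 < c) (hle : k ≤ c • l) (heq : k i = c * l i) : G l i < G k i :=
  (hG.lt_apply_smul hl hi hc).trans_le (hG.apply_le_apply hk hle heq)

theorem apply_le_of_le_smul (hG : IsCurvatureMap G) (hk : 0 ≤ k) (hl : 0 ≤ l) (hi : 0 < l i) {c : ℝ}
    (hc : 1 ≤ c) (hle : k ≤ c • l) (heq : k i = c * l i) : G l i ≤ G k i := by
  rcases hc.eq_or_lt with rfl | hc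
  · rw [one_smul] at hle
    rw [one_mul] at heq
    exact hG.apply_le_apply hk hle heq
  · exact (hG.apply_lt_of_le_smul hk hl hi hc hle heq).le

theorem injOn [Finite F] (hG : IsCurvatureMap G) : InjOn G (Ici 0) := by
  suffices hle : ∀ ⦃k⦄, 0 ≤ k → ∀ ⦃l⦄, 0 ≤ l → G k = G l → k ≤ l from
    fun k hk l hl h => (hle hk hl h).antisymm (hle hl hk h.symm)
  intro k hk l hl h
  by_contra hkl
  obtain ⟨j, hj⟩ := not_forall.1 hkl
  have hsupp : ∀ {x}, 0 < k x → 0 < l x := fun hx => by rwa [← hG.pos_iff hl, ← h, hG.pos_iff hk]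
  have : Nonempty F := ⟨j⟩
  obtain ⟨i, hi⟩ := Finite.exists_max fun x => k x / l x
  set c := k i / l i
  have hlj : 0 < l j := hsupp ((hl j).trans_lt (not_le.1 hj))
  have hc1 : 1 < c := ((one_lt_div hlj).2 (not_le.1 hj)).trans_le (hi j)
  have hli : 0 < l i := (hl i).lt_of_ne' fun h0 => by
    exact hc1.not_ge ((div_eq_zero_iff.2 (.inr h0)).trans_le zero_le_one)
  have hmax : k ≤ c • l := fun x => by
    rcases (hl x).eq_or_lt' with hx | hx
    · have hkx : k x ≤ 0 := not_lt.1 fun hkx => (hsupp hkx).ne' hx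
      exact hkx.trans (mul_nonneg (one_pos.trans hc1).le (hl x))
    · exact (div_le_iff₀ hx).1 (hi x)
  exact (hG.apply_lt_of_le_smul hk hl hli hc1 hmax (div_mul_cancel₀ _ hli.ne').symm).ne
    (congrFun h.symm i)

end IsCurvatureMap

/-! ### Perron's method -/

/-- The subsolutions of `G k = L` above `l`. -/
def subsolutions {F : Type*} (G : (F → ℝ) → F → ℝ) (L l : F → ℝ) : Set (F → ℝ) :=
  {k | l ≤ k ∧ G k ≤ L}

namespace IsCurvatureMap

variable {F : Type*} {G : (F → ℝ) → F → ℝ} {l m L : F → ℝ} {I : Finset F}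

theorem supClosed_subsolutions (hG : IsCurvatureMap G) (hl : 0 ≤ l) :
    SupClosed (subsolutions G L l) := by
  intro k hk k' hk'
  refine ⟨hk.1.trans le_sup_left, fun i => ?_⟩
  rcases le_total (k i) (k' i) with h | h
  · exact (hG.apply_le_apply (hl.trans hk'.1) le_sup_right (sup_of_le_right h).symm).trans (hk'.2 i)
  · exact (hG.apply_le_apply (hl.trans hk.1) le_sup_left (sup_of_le_left h).symm).trans (hk.2 i)

theorem isClosed_subsolutions (hG : IsCurvatureMap G) (hl : 0 ≤ l) :
    IsClosed (subsolutions G L l) :=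
  (hG.continuousOn.mono (Ici_subset_Ici.2 hl)).preimage_isClosed_of_isClosed isClosed_Ici
    isClosed_Iic

theorem exists_mem_stratum_apply_le (hG : IsCurvatureMap G) (hL : L ∈ stratum I) :
    ∃ l ∈ stratum I, G l ≤ L := by
  classical
  set e : F → ℝ := fun i => if i ∈ I then 1 else 0
  have he : 0 ≤ e := fun i => by
    by_cases hi : i ∈ I <;> simp [e, hi]
  have hsmall : ∀ᶠ c : ℝ in 𝓝[>] 0, ∀ i ∈ I, G (c • e) i < L i := by
    rw [eventually_all_finset]
    exact fun i hi => (hG.tendsto_smul he i).eventually_lt_const (hL.1 i hi)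
  obtain ⟨c, hc, hc0⟩ := (hsmall.and self_mem_nhdsWithin).exists
  have hmem : c • e ∈ stratum I :=
    ⟨fun i hi => by simpa [e, hi] using hc0, fun i hi => by simp [e, hi]⟩
  refine ⟨c • e, hmem, fun i => ?_⟩
  by_cases hi : i ∈ I
  · exact (hc i hi).le
  · rw [hL.2 i hi, hG.apply_eq_zero (hmem.2 i hi)]

theorem apply_eq_of_isGreatest (hG : IsCurvatureMap G) (hl : 0 ≤ l)
    (hm : IsGreatest (subsolutions G L l) m) : G m = L := by
  classical
  have hm0 : 0 ≤ m := hl.trans hm.1.1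
  refine funext fun i => (hm.1.2 i).eq_or_lt.resolve_right fun hlt => ?_
  have hle : ∀ {y}, m i < y → m ≤ Function.update m i y := fun hy =>
    le_update_iff.2 ⟨hy.le, fun _ _ => le_rfl⟩
  have hupdate : Tendsto (fun y => Function.update m i y) (𝓝[>] (m i)) (𝓝[Ici 0] m) := by
    refine tendsto_nhdsWithin_iff.2 ⟨?_, ?_⟩
    · have hcont : Continuous fun y => Function.update m i y :=
        continuous_const.update i continuous_id
      simpa only [Function.update_eq_self] using (hcont.tendsto (m i)).mono_left nhdsWithin_le_nhds
    · filter_upwards [self_mem_nhdsWithin] with y hy using hm0.trans (hle hy)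
  have hlim := tendsto_pi_nhds.1 ((hG.continuousOn m hm0).tendsto.comp hupdate) i
  obtain ⟨y, hy, hmy⟩ := ((hlim.eventually_lt_const hlt).and self_mem_nhdsWithin).exists
  have hmem : Function.update m i y ∈ subsolutions G L l := by
    refine ⟨hm.1.1.trans (hle hmy), fun j => ?_⟩
    rcases eq_or_ne j i with rfl | hj
    · exact hy.le
    · exact (hG.apply_le_apply hm0 (hle hmy) (Function.update_of_ne hj _ _).symm).trans (hm.1.2 j)
  have hym : Function.update m i y i ≤ m i := hm.2 hmem i
  rw [Function.update_self] at hym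
  exact hmy.not_ge hym

end IsCurvatureMap

/-! ### Total geodesic curvatures -/

section TotalCurvature

theorem tendsto_sum_mul_flatAngle {E : Type*} {Φ : E → ℝ}
    (hΦ : ∀ e, Φ e ∈ Ioo 0 (Real.pi / 2)) (B : Finset E) (D : ℝ) :
    Tendsto (fun R => ∑ e ∈ B, 2 * Real.cos (arccot R) * flatAngle (Φ e) R D) atTop
      (𝓝 (2 * ∑ e ∈ B, Φ e)) := by
  rw [Finset.mul_sum]
  refine tendsto_finsetSum _ fun e _ => ?_
  simpa only [mul_one] using
    (tendsto_cos_arccot_atTop.const_mul 2).mul (tendsto_flatAngle_atTop (hΦ e) D)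

variable {E F : Type*} [Fintype E] [DecidableEq F] {f₁ f₂ : E → F} {Φ : E → ℝ}

/-
The two copies of `E` are the two sides of the bigons, so that all summands have the same form.
-/
theorem totalCurvature_eq_sum (f₁ f₂ : E → F) (Φ : E → ℝ) (k : F → ℝ) (i : F) :
    totalCurvature f₁ f₂ Φ k i = ∑ d : E ⊕ E with Sum.elim f₁ f₂ d = i,
      sideCurvature (Φ (Sum.elim id id d)) (k i) (k (Sum.elim f₂ f₁ d)) := by
  rw [totalCurvature, Finset.sum_filter, Fintype.sum_sum_type, Finset.sum_add_distrib]
  rfl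

theorem isCurvatureMap_totalCurvature (hΦ : ∀ e, Φ e ∈ Ioo 0 (Real.pi / 2))
    (hE : ∀ i, ∃ e, f₁ e = i ∨ f₂ e = i) : IsCurvatureMap (totalCurvature f₁ f₂ Φ) where
  continuousOn := by
    simp only [continuousOn_pi, totalCurvature_eq_sum]
    refine fun i => continuousOn_finsetSum _ fun d _ => ?_
    exact (continuousOn_sideCurvature (hΦ _)).comp
      (f := fun k : F → ℝ => (k i, k (Sum.elim f₂ f₁ d))) (by fun_prop) fun k hk => ⟨hk _, hk _⟩
  apply_eq_zero hi := by
    simp only [totalCurvature_eq_sum, hi, sideCurvature_zero, Finset.sum_const_zero]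
  apply_le_apply hk hkl hi := by
    simp only [totalCurvature_eq_sum, ← hi]
    exact Finset.sum_le_sum fun d _ =>
      sideCurvature_antitoneOn (hΦ _) (hk _) (hk _) ((hk _).trans (hkl _)) (hkl _)
  lt_apply_smul {k i c} hk hi hc := by
    simp only [totalCurvature_eq_sum]
    refine Finset.sum_lt_sum_of_nonempty ?_ fun d _ => sideCurvature_lt_mul (hΦ _) hi (hk _) hc
    obtain ⟨e, he | he⟩ := hE i
    · exact ⟨.inl e, by simpa using he⟩
    · exact ⟨.inr e, by simpa using he⟩

theorem totalCurvature_le (hΦ : ∀ e, Φ e ∈ Ioo 0 (Real.pi / 2)) {k : F → ℝ} (hk : 0 ≤ k) (i : F) :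
    totalCurvature f₁ f₂ Φ k i ≤ Fintype.card (E ⊕ E) * Real.pi := by
  rw [totalCurvature_eq_sum]
  refine (Finset.sum_le_card_nsmul _ _ _ fun d _ =>
    sideCurvature_le_pi (hΦ _) (hk _) (hk _)).trans ?_
  rw [nsmul_eq_mul]
  gcongr
  exact Finset.card_le_univ _

theorem abs_totalCurvature_exp_sub_le (hΦ : ∀ e, Φ e ∈ Ioo 0 (Real.pi / 2)) {s t : F → ℝ} {δ : ℝ}
    (hδ : ∀ j, |s j - t j| ≤ δ) (i : F) :
    |totalCurvature f₁ f₂ Φ (fun j => Real.exp (s j)) i -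
      totalCurvature f₁ f₂ Φ (fun j => Real.exp (t j)) i| ≤ Fintype.card (E ⊕ E) * (10 * δ) := by
  have hδ0 : 0 ≤ δ := (abs_nonneg _).trans (hδ i)
  rw [totalCurvature_eq_sum, totalCurvature_eq_sum, ← Finset.sum_sub_distrib]
  refine (Finset.abs_sum_le_sum_abs _ _).trans ((Finset.sum_le_card_nsmul _ _ _ fun d _ =>
    abs_sideCurvature_exp_sub_le (hΦ _) (hδ _) (hδ _)).trans ?_)
  rw [nsmul_eq_mul]
  gcongr
  exact Finset.card_le_univ _

theorem sum_totalCurvature (k : F → ℝ) (A : Finset F) :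
    ∑ i ∈ A, totalCurvature f₁ f₂ Φ k i =
      ∑ e, ((if f₁ e ∈ A then sideCurvature (Φ e) (k (f₁ e)) (k (f₂ e)) else 0) +
        (if f₂ e ∈ A then sideCurvature (Φ e) (k (f₂ e)) (k (f₁ e)) else 0)) := by
  simp only [totalCurvature]
  rw [Finset.sum_comm]
  simp only [Finset.sum_add_distrib, Finset.sum_ite_eq]

theorem sum_mul_flatAngle_le_sum_totalCurvature (hΦ : ∀ e, Φ e ∈ Ioo 0 (Real.pi / 2)) {k : F → ℝ}
    (hk : 0 ≤ k) {A : Finset F} {R D : ℝ} (hR : 0 < R) (hD : 0 < D) (hA : ∀ i ∈ A, R ≤ k i)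
    (hA' : ∀ i ∉ A, k i ≤ D) :
    ∑ e ∈ boundaryEdges f₁ f₂ A, 2 * Real.cos (arccot R) * flatAngle (Φ e) R D ≤
      ∑ i ∈ A, totalCurvature f₁ f₂ Φ k i := by
  rw [sum_totalCurvature, boundaryEdges, Finset.sum_filter]
  refine Finset.sum_le_sum fun e _ => ?_
  by_cases h₁ : f₁ e ∈ A <;> by_cases h₂ : f₂ e ∈ A <;>
    simp only [h₁, h₂, if_true, if_false, or_true, or_false, or_self, add_zero, zero_add, le_refl]
  · exact mul_flatAngle_le_sideCurvature_add (hΦ e) hR (hA _ h₁) (hA _ h₂) hD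
  · exact mul_flatAngle_le_sideCurvature_of_le (hΦ e) hR (hA _ h₁) (hk _) (hA' _ h₂)
  · exact mul_flatAngle_le_sideCurvature_of_le (hΦ e) hR (hA _ h₂) (hk _) (hA' _ h₁)

variable {I : Finset F} {L l : F → ℝ}

theorem bddAbove_subsolutions [Finite F] (hΦ : ∀ e, Φ e ∈ Ioo 0 (Real.pi / 2))
    (hE : ∀ i, ∃ e, f₁ e = i ∨ f₂ e = i) (hL : L ∈ prescribedCurvatures f₁ f₂ Φ I) (hl : 0 ≤ l) :
    BddAbove (subsolutions (totalCurvature f₁ f₂ Φ) L l) := by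
  have hG := isCurvatureMap_totalCurvature hΦ hE
  by_contra hbdd
  obtain ⟨A, hA, D, hD⟩ :=
    exists_finset_forall_exists_lt_of_not_bddAbove (hG.supClosed_subsolutions hl) hbdd
  have hAI : A ⊆ I := fun i hi => by
    obtain ⟨k, hk, hkA, -⟩ := hD 0
    by_contra hiI
    have hpos := (hG.pos (hl.trans hk.1) (hkA i hi)).trans_le (hk.2 i)
    exact hpos.ne' (hL.2.1 i hiI)
  refine (hL.2.2 A hAI hA).not_ge
    (le_of_tendsto (tendsto_sum_mul_flatAngle hΦ _ (max D 1)) ?_)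
  filter_upwards [eventually_gt_atTop 0] with R hR
  obtain ⟨k, hk, hkA, hkA'⟩ := hD R
  calc ∑ e ∈ boundaryEdges f₁ f₂ A, 2 * Real.cos (arccot R) * flatAngle (Φ e) R (max D 1)
      ≤ ∑ i ∈ A, totalCurvature f₁ f₂ Φ k i :=
        sum_mul_flatAngle_le_sum_totalCurvature hΦ (hl.trans hk.1) hR
          (one_pos.trans_le (le_max_right _ _)) (fun i hi => (hkA i hi).le)
          fun i hi => (hkA' i hi).trans (le_max_left _ _)
    _ ≤ ∑ i ∈ A, L i := Finset.sum_le_sum fun i _ => hk.2 i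

theorem exists_mem_stratum_totalCurvature_eq [Finite F] (hΦ : ∀ e, Φ e ∈ Ioo 0 (Real.pi / 2))
    (hE : ∀ i, ∃ e, f₁ e = i ∨ f₂ e = i) (hL : L ∈ prescribedCurvatures f₁ f₂ Φ I) :
    ∃ k ∈ stratum I, totalCurvature f₁ f₂ Φ k = L := by
  have hG := isCurvatureMap_totalCurvature hΦ hE
  obtain ⟨l, hl, hlL⟩ := hG.exists_mem_stratum_apply_le ⟨hL.1, hL.2.1⟩
  have hl0 := nonneg_of_mem_stratum hl
  obtain ⟨k, hk⟩ := exists_isGreatest_of_supClosed (hG.supClosed_subsolutions hl0)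
    (hG.isClosed_subsolutions hl0) ⟨l, le_rfl, hlL⟩ (bddAbove_subsolutions hΦ hE hL hl0)
  have hkL := hG.apply_eq_of_isGreatest hl0 hk
  have hk0 : 0 ≤ k := hl0.trans hk.1.1
  refine ⟨k, ⟨fun i hi => ?_, fun i hi => ?_⟩, hkL⟩
  · exact (hl.1 i hi).trans_le (hk.1.1 i)
  · refine (hk0 i).antisymm' (not_lt.1 fun hpos => ?_)
    exact ((hG.pos_iff hk0).2 hpos).ne' ((congrFun hkL i).trans (hL.2.1 i hi))

end TotalCurvature

/-! ### The flow in logarithmic coordinates -/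

/-- The vector field of the flow `k' = (L - G k) k` in the coordinates `log k`. -/
noncomputable def logField {F : Type*} (G : (F → ℝ) → F → ℝ) (L s : F → ℝ) : F → ℝ :=
  fun i => L i - G (fun j => Real.exp (s j)) i

namespace IsCurvatureMap

variable {F : Type*} {G : (F → ℝ) → F → ℝ} {k l L : F → ℝ} {s : ℝ → F → ℝ} {i : F}

theorem exists_apply_lt (hG : IsCurvatureMap G) (hk : 0 ≤ k) {a : ℝ} (ha : a < k i) :
    ∃ l : F → ℝ, 0 ≤ l ∧ (∀ j, 0 < l j → G l j < G k j) ∧ a < l i := by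
  obtain ⟨c, ⟨hca, hc0⟩, hc1⟩ : ∃ c, (a < c * k i ∧ 0 < c) ∧ c < 1 := by
    have hlim : Tendsto (fun c => c * k i) (𝓝[<] 1) (𝓝 (1 * k i)) :=
      ((continuous_mul_const (k i)).tendsto 1).mono_left nhdsWithin_le_nhds
    rw [one_mul] at hlim
    exact (((hlim.eventually_const_lt ha).and
      (mem_nhdsWithin_of_mem_nhds (Ioi_mem_nhds one_pos))).and self_mem_nhdsWithin).exists
  have hck : 0 ≤ c • k := smul_nonneg hc0.le hk
  refine ⟨c • k, hck, fun j hj => ?_, hca⟩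
  have hlt := hG.lt_apply_smul hck hj ((one_lt_inv₀ hc0).2 hc1)
  rwa [inv_smul_smul₀ hc0.ne'] at hlt

variable [Finite F]

/-
At a time when `s i - log (l i)` is maximal and nonnegative, `exp s` touches a multiple `c • l` with
`1 ≤ c` from below in the coordinate `i`, so `G (exp s) i` is at least `G l i`.
-/
theorem eventually_exp_lt (hG : IsCurvatureMap G)
    (hs : ∀ t, HasDerivAt s (logField G L (s t)) t) (hl : ∀ i, 0 < l i) (hlL : ∀ i, L i < G l i)
    {b : ℝ} (hb : l i < b) : ∀ᶠ t in atTop, Real.exp (s t i) < b := by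
  obtain ⟨c, hc, hgap⟩ := exists_pos_forall_le_of_finite fun i => sub_pos.2 (hlL i)
  have hlt : ∀ᶠ t in atTop, ∀ j, s t j - Real.log (l j) < Real.log b - Real.log (l i) := by
    refine eventually_lt_of_deriv_le_neg hc
      (fun t _ j => (hasDerivAt_pi.1 (hs t) j).sub_const _) (fun t _ j hmax h0 => ?_)
      (sub_pos.2 (Real.log_lt_log (hl i) hb))
    have hle : ∀ x, Real.exp (s t x) ≤ Real.exp (s t j - Real.log (l j)) * l x := fun x => by
      rw [← Real.exp_log (hl x), ← Real.exp_add, Real.exp_le_exp]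
      linarith [hmax x]
    have heq : Real.exp (s t j) = Real.exp (s t j - Real.log (l j)) * l j := by
      rw [Real.exp_sub, Real.exp_log (hl j), div_mul_cancel₀ _ (hl j).ne']
    have hGl := hG.apply_le_of_le_smul (fun x => (Real.exp_pos _).le) (fun x => (hl x).le) (hl j)
      (Real.one_le_exp h0) hle heq
    rw [logField]
    linarith [hgap j]
  filter_upwards [hlt] with t ht
  rw [← Real.lt_log_iff_exp_lt ((hl i).trans hb)]
  linarith [ht i]

theorem eventually_lt_exp (hG : IsCurvatureMap G)
    (hs : ∀ t, HasDerivAt s (logField G L (s t)) t) (hl : 0 ≤ l)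
    (hlL : ∀ i, 0 < l i → G l i < L i) {a : ℝ} (ha : a < l i) :
    ∀ᶠ t in atTop, a < Real.exp (s t i) := by
  rcases le_or_gt a 0 with ha0 | ha0
  · exact Eventually.of_forall fun t => ha0.trans_lt (Real.exp_pos _)
  have hli : 0 < l i := ha0.trans ha
  obtain ⟨c, hc, hgap⟩ := exists_pos_forall_le_of_finite fun j : {j // 0 < l j} =>
    sub_pos.2 (hlL j j.2)
  have hlt : ∀ᶠ t in atTop, ∀ j : {j // 0 < l j},
      Real.log (l j) - s t j < Real.log (l i) - Real.log a := by
    refine eventually_lt_of_deriv_le_neg (u := fun t (j : {j // 0 < l j}) => Real.log (l j) - s t j)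
      hc (fun t _ j => (hasDerivAt_pi.1 (hs t) j).const_sub _) (fun t _ j hmax h0 => ?_)
      (sub_pos.2 (Real.log_lt_log ha0 ha))
    have hle : ∀ x, l x ≤ Real.exp (Real.log (l j) - s t j) * Real.exp (s t x) := fun x => by
      rcases (hl x).eq_or_lt' with hx | hx
      · rw [hx]
        positivity
      · rw [← Real.exp_add, ← Real.log_le_iff_le_exp hx]
        linarith [hmax ⟨x, hx⟩]
    have heq : l j = Real.exp (Real.log (l j) - s t j) * Real.exp (s t j) := by
      rw [← Real.exp_add, sub_add_cancel, Real.exp_log j.2]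
    have hGl := hG.apply_le_of_le_smul hl (fun x => (Real.exp_pos (s t x)).le) (Real.exp_pos _)
      (Real.one_le_exp h0) hle heq
    rw [logField]
    linarith [hgap j]
  filter_upwards [hlt] with t ht
  rw [← Real.log_lt_iff_lt_exp ha0]
  linarith [ht ⟨i, hli⟩]

/-
The supersolution is a multiple `c • k` with `1 < c`, shifted by a small constant to become
positive; the coordinates where `k` vanishes need no continuity, since `G` is positive there.
-/
theorem exists_lt_apply (hG : IsCurvatureMap G) (hk : 0 ≤ k) {b : ℝ} (hb : k i < b) :
    ∃ l : F → ℝ, (∀ j, 0 < l j) ∧ (∀ j, G k j < G l j) ∧ l i < b := by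
  obtain ⟨c, hcb, hc⟩ : ∃ c, c * k i < b ∧ 1 < c := by
    have hlim : Tendsto (fun c => c * k i) (𝓝[>] 1) (𝓝 (1 * k i)) :=
      ((continuous_mul_const (k i)).tendsto 1).mono_left nhdsWithin_le_nhds
    rw [one_mul] at hlim
    exact ((hlim.eventually_lt_const hb).and self_mem_nhdsWithin).exists
  have hck : 0 ≤ c • k := smul_nonneg (one_pos.trans hc).le hk
  set l : ℝ → F → ℝ := fun y j => c * k j + y
  have hpos : ∀ {y}, 0 < y → ∀ j, 0 < l y j := fun hy j => add_pos_of_nonneg_of_pos (hck j) hy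
  have hlim : Tendsto l (𝓝[>] 0) (𝓝[Ici 0] (c • k)) := by
    refine tendsto_nhdsWithin_iff.2 ⟨?_, ?_⟩
    · have hcont : Continuous l := by fun_prop
      have hl0 : l 0 = c • k := funext fun j => add_zero _
      exact hl0 ▸ (hcont.tendsto 0).mono_left nhdsWithin_le_nhds
    · filter_upwards [self_mem_nhdsWithin] with y hy using fun j => (hpos hy j).le
  have hlimG := tendsto_pi_nhds.1 ((hG.continuousOn _ hck).tendsto.comp hlim)
  have hsuper : ∀ᶠ y in 𝓝[>] (0 : ℝ), ∀ j, G k j < G (l y) j := eventually_all.2 fun j => by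
    rcases (hk j).eq_or_lt' with hj | hj
    · filter_upwards [self_mem_nhdsWithin] with y hy
      exact (hG.apply_eq_zero hj).trans_lt (hG.pos (fun x => (hpos hy x).le) (hpos hy j))
    · exact (hlimG j).eventually_const_lt (hG.lt_apply_smul hk hj hc)
  have hlt := (tendsto_pi_nhds.1 (hlim.mono_right nhdsWithin_le_nhds) i).eventually_lt_const hcb
  obtain ⟨y, ⟨hy, hyb⟩, hy0⟩ := ((hsuper.and hlt).and self_mem_nhdsWithin).exists
  exact ⟨l y, hpos hy0, hy, hyb⟩

theorem tendsto_exp (hG : IsCurvatureMap G) (hk : 0 ≤ k)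
    (hs : ∀ t, HasDerivAt s (logField G (G k) (s t)) t) :
    Tendsto (fun t i => Real.exp (s t i)) atTop (𝓝 k) := by
  refine tendsto_pi_nhds.2 fun i => tendsto_order.2 ⟨fun a ha => ?_, fun b hb => ?_⟩
  · obtain ⟨l, hl, hlk, hal⟩ := hG.exists_apply_lt hk ha
    exact hG.eventually_lt_exp hs hl hlk hal
  · obtain ⟨l, hl, hkl, hlb⟩ := hG.exists_lt_apply hk hb
    exact hG.eventually_exp_lt hs hl hkl hlb

end IsCurvatureMap

section Flow

variable {E F : Type*} [Fintype E] [DecidableEq F] {f₁ f₂ : E → F} {Φ : E → ℝ} {I : Finset F}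
  {L : F → ℝ}

theorem flow_velocity_eq (hL : ∀ i ∉ I, L i = 0) (k : F → ℝ) (i : F) :
    (if i ∈ I then -(totalCurvature f₁ f₂ Φ k i - L i) * k i
      else -totalCurvature f₁ f₂ Φ k i * k i) = (L i - totalCurvature f₁ f₂ Φ k i) * k i := by
  split_ifs with hi
  · ring
  · rw [hL i hi]
    ring

theorem IsFlowOn.mono {J J' : Set ℝ} {k : ℝ → F → ℝ} (hk : IsFlowOn f₁ f₂ Φ I L J k)
    (h : J' ⊆ J) : IsFlowOn f₁ f₂ Φ I L J' k := fun t ht i =>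
  (hk t (h ht) i).imp_right fun hderiv => hderiv.mono h

theorem IsFlowOn.hasDerivWithinAt_log (hL : ∀ i ∉ I, L i = 0) {J : Set ℝ} {k : ℝ → F → ℝ}
    (hk : IsFlowOn f₁ f₂ Φ I L J k) {t : ℝ} (ht : t ∈ J) :
    HasDerivWithinAt (fun s i => Real.log (k s i))
      (logField (totalCurvature f₁ f₂ Φ) L fun i => Real.log (k t i)) J t := by
  refine hasDerivWithinAt_pi.2 fun i => ?_
  obtain ⟨hpos, hderiv⟩ := hk t ht i
  have hexp : (fun j => Real.exp (Real.log (k t j))) = k t :=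
    funext fun j => Real.exp_log (hk t ht j).1
  refine (hderiv.log hpos.ne').congr_deriv ?_
  rw [flow_velocity_eq hL, mul_div_cancel_right₀ _ hpos.ne', logField, hexp]

theorem isFlowOn_exp (hL : ∀ i ∉ I, L i = 0) {s : ℝ → F → ℝ}
    (hs : ∀ t, HasDerivAt s (logField (totalCurvature f₁ f₂ Φ) L (s t)) t) (J : Set ℝ) :
    IsFlowOn f₁ f₂ Φ I L J fun t i => Real.exp (s t i) := by
  intro t _ i
  refine ⟨Real.exp_pos _, ?_⟩
  rw [flow_velocity_eq hL, mul_comm]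
  exact (hasDerivAt_pi.1 (hs t) i).exp.hasDerivWithinAt

theorem lipschitzWith_logField [Fintype F] (hΦ : ∀ e, Φ e ∈ Ioo 0 (Real.pi / 2)) :
    LipschitzWith (Fintype.card (E ⊕ E) * 10) (logField (totalCurvature f₁ f₂ Φ) L) := by
  refine LipschitzWith.of_dist_le_mul fun s t => (dist_pi_le_iff (by positivity)).2 fun i => ?_
  rw [Real.dist_eq, logField, logField, sub_sub_sub_cancel_left, abs_sub_comm]
  refine (abs_totalCurvature_exp_sub_le hΦ (δ := dist s t) (dist_le_pi_dist s t) i).trans_eq ?_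
  push_cast
  ring

theorem norm_logField_le [Fintype F] (hΦ : ∀ e, Φ e ∈ Ioo 0 (Real.pi / 2))
    (hE : ∀ i, ∃ e, f₁ e = i ∨ f₂ e = i) (s : F → ℝ) :
    ‖logField (totalCurvature f₁ f₂ Φ) L s‖ ≤ ‖L‖ + Fintype.card (E ⊕ E) * Real.pi := by
  refine (pi_norm_le_iff_of_nonneg (by positivity)).2 fun i => ?_
  refine (norm_sub_le _ _).trans (add_le_add (norm_le_pi_norm L i) ?_)
  have hexp : 0 ≤ fun j => Real.exp (s j) := fun j => (Real.exp_pos _).le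
  rw [Real.norm_of_nonneg
    ((isCurvatureMap_totalCurvature hΦ hE).pos hexp (Real.exp_pos (s i))).le]
  exact totalCurvature_le hΦ hexp i

variable [Finite F]

theorem exists_forall_hasDerivAt_logField (hΦ : ∀ e, Φ e ∈ Ioo 0 (Real.pi / 2))
    (hE : ∀ i, ∃ e, f₁ e = i ∨ f₂ e = i) (s₀ : F → ℝ) :
    ∃ s : ℝ → F → ℝ, s 0 = s₀ ∧
      ∀ t, HasDerivAt s (logField (totalCurvature f₁ f₂ Φ) L (s t)) t := by
  have := Fintype.ofFinite F
  exact exists_forall_hasDerivAt_of_lipschitzWith (lipschitzWith_logField hΦ)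
    (M := ⟨‖L‖ + Fintype.card (E ⊕ E) * Real.pi, by positivity⟩) (norm_logField_le hΦ hE) s₀

theorem IsFlowOn.eqOn (hΦ : ∀ e, Φ e ∈ Ioo 0 (Real.pi / 2)) (hL : ∀ i ∉ I, L i = 0) {T : ℝ}
    {k l : ℝ → F → ℝ} (hk : IsFlowOn f₁ f₂ Φ I L (Ico 0 T) k)
    (hl : IsFlowOn f₁ f₂ Φ I L (Ico 0 T) l) (h0 : k 0 = l 0) : EqOn k l (Ico 0 T) := by
  have := Fintype.ofFinite F
  intro t ht
  have hsub : Icc 0 t ⊆ Ico 0 T := fun x hx => ⟨hx.1, hx.2.trans_lt ht.2⟩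
  have hcont : ∀ {m : ℝ → F → ℝ}, IsFlowOn f₁ f₂ Φ I L (Ico 0 T) m →
      ContinuousOn (fun s i => Real.log (m s i)) (Icc 0 t) := fun hm x hx =>
    (hm.hasDerivWithinAt_log hL (hsub hx)).continuousWithinAt.mono hsub
  have hderiv : ∀ {m : ℝ → F → ℝ}, IsFlowOn f₁ f₂ Φ I L (Ico 0 T) m → ∀ x ∈ Ico 0 t,
      HasDerivWithinAt (fun s i => Real.log (m s i))
        (logField (totalCurvature f₁ f₂ Φ) L fun i => Real.log (m x i)) (Ici x) x :=
    fun hm x hx =>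
    (hm.hasDerivWithinAt_log hL (hsub (Ico_subset_Icc_self hx))).mono_of_mem_nhdsWithin
      (mem_of_superset (Ico_mem_nhdsGE (hx.2.trans ht.2)) (Ico_subset_Ico_left hx.1))
  have hlog := ODE_solution_unique (v := fun _ => logField (totalCurvature f₁ f₂ Φ) L)
    (fun _ => lipschitzWith_logField hΦ) (hcont hk) (hderiv hk) (hcont hl) (hderiv hl)
    (by rw [h0]) (right_mem_Icc.2 ht.1)
  exact funext fun i => Real.log_injOn_pos (hk t ht i).1 (hl t ht i).1 (congrFun hlog i)

theorem exists_isFlowOn_tendsto (hΦ : ∀ e, Φ e ∈ Ioo 0 (Real.pi / 2))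
    (hE : ∀ i, ∃ e, f₁ e = i ∨ f₂ e = i) (hL : ∀ i ∉ I, L i = 0) {khat : F → ℝ} (hk : 0 ≤ khat)
    (hkL : totalCurvature f₁ f₂ Φ khat = L) {k₀ : F → ℝ} (hk₀ : ∀ i, 0 < k₀ i) :
    ∃ k : ℝ → F → ℝ, k 0 = k₀ ∧ IsFlowOn f₁ f₂ Φ I L (Ici 0) k ∧
      Tendsto k atTop (𝓝 khat) := by
  subst hkL
  obtain ⟨s, hs0, hs⟩ := exists_forall_hasDerivAt_logField (f₁ := f₁) (f₂ := f₂)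
    (L := totalCurvature f₁ f₂ Φ khat) hΦ hE fun i => Real.log (k₀ i)
  refine ⟨fun t i => Real.exp (s t i), funext fun i => ?_, isFlowOn_exp hL hs _,
    (isCurvatureMap_totalCurvature hΦ hE).tendsto_exp hk hs⟩
  beta_reduce
  rw [hs0, Real.exp_log (hk₀ i)]

end Flow

theorem isDegenerated_of_mem_stratum {F : Type*} [Fintype F] {I : Finset F} (hI : I ≠ Finset.univ)
    {k : F → ℝ} (hk : k ∈ stratum I) : IsDegenerated k := by
  obtain ⟨i, hi⟩ := not_forall.1 (mt Finset.eq_univ_iff_forall.2 hI)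
  exact ⟨nonneg_of_mem_stratum hk, i, hk.2 i hi⟩

end CirclePattern

open CirclePattern in
theorem theorem1p9_general {E F : Type*} [Fintype E] [Finite F] [DecidableEq F] {f₁ f₂ : E → F}
    {Φ : E → ℝ} (hΦ : ∀ e, Φ e ∈ Ioo 0 (Real.pi / 2)) (hE : ∀ i, ∃ e, f₁ e = i ∨ f₂ e = i)
    {I : Finset F} {Lhat : F → ℝ} (hL : Lhat ∈ prescribedCurvatures f₁ f₂ Φ I) :
    ∃ khat : F → ℝ,
      totalCurvature f₁ f₂ Φ khat = Lhat ∧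
      (∀ k', 0 ≤ k' → totalCurvature f₁ f₂ Φ k' = Lhat → k' = khat) ∧
      khat ∈ stratum I ∧
      ∀ k₀ : F → ℝ, (∀ i, 0 < k₀ i) →
        ∃ k : ℝ → F → ℝ,
          k 0 = k₀ ∧
          IsFlowOn f₁ f₂ Φ I Lhat (Ici 0) k ∧
          (∀ (T : ℝ) (k' : ℝ → F → ℝ), k' 0 = k₀ →
            IsFlowOn f₁ f₂ Φ I Lhat (Ico 0 T) k' → EqOn k' k (Ico 0 T)) ∧
          Tendsto k atTop (𝓝 khat) := by
  obtain ⟨khat, hkI, hkL⟩ := exists_mem_stratum_totalCurvature_eq hΦ hE hL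
  have hk := nonneg_of_mem_stratum hkI
  refine ⟨khat, hkL, fun k' hk' hkL' => ?_, hkI, fun k₀ hk₀ => ?_⟩
  · exact (isCurvatureMap_totalCurvature hΦ hE).injOn hk' hk (hkL'.trans hkL.symm)
  · obtain ⟨k, hk0, hflow, hlim⟩ := exists_isFlowOn_tendsto hΦ hE hL.2.1 hk hkL hk₀
    refine ⟨k, hk0, hflow, fun T k' hk0' hflow' => ?_, hlim⟩
    exact hflow'.eqOn hΦ hL.2.1 (hflow.mono Ico_subset_Ici_self) (hk0'.trans hk0.symm)

theorem theorem1p9 {S : Type*} [TopologicalSpace S] [T2Space S] [CompactSpace S] [ConnectedSpace S]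
    [ChartedSpace (EuclideanSpace ℝ (Fin 2)) S]
    [CWComplex (univ : Set S)] [∀ n, Fintype (RelCWComplex.cell (univ : Set S) n)]
    (hdim : ∀ n, 2 < n → IsEmpty (RelCWComplex.cell (univ : Set S) n))
    [DecidableEq (CirclePattern.Faces S)]
    (f₁ f₂ : CirclePattern.Edges S → CirclePattern.Faces S)
    (hsides : ∀ e, CirclePattern.LieOnTwoSides e (f₁ e) (f₂ e))
    (Φ : CirclePattern.Edges S → ℝ) (hΦ : ∀ e, Φ e ∈ Ioo 0 (Real.pi / 2))
    (I : Finset (CirclePattern.Faces S)) (hI : I.Nonempty) (hI' : I ≠ Finset.univ)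
    (Lhat : CirclePattern.Faces S → ℝ)
    (hL : Lhat ∈ CirclePattern.prescribedCurvatures f₁ f₂ Φ I) :
    ∃ khat : CirclePattern.Faces S → ℝ,
      (CirclePattern.IsDegenerated khat ∧ CirclePattern.totalCurvature f₁ f₂ Φ khat = Lhat) ∧
      (∀ k', CirclePattern.IsDegenerated k' →
        CirclePattern.totalCurvature f₁ f₂ Φ k' = Lhat → k' = khat) ∧
      khat ∈ CirclePattern.stratum I ∧
      ∀ k₀ : CirclePattern.Faces S → ℝ, (∀ i, 0 < k₀ i) →
        ∃ k : ℝ → CirclePattern.Faces S → ℝ,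
          k 0 = k₀ ∧
          CirclePattern.IsFlowOn f₁ f₂ Φ I Lhat (Ici 0) k ∧
          (∀ (T : ℝ) (k' : ℝ → CirclePattern.Faces S → ℝ), k' 0 = k₀ →
            CirclePattern.IsFlowOn f₁ f₂ Φ I Lhat (Ico 0 T) k' → EqOn k' k (Ico 0 T)) ∧
          Tendsto k atTop (𝓝 khat) := by
  have := nontrivial_of_nonempty_of_ne_univ hI hI'
  obtain ⟨khat, hkL, hunique, hkI, hflow⟩ :=
    theorem1p9_general hΦ (CirclePattern.exists_edge_of_face hdim hsides) hL
  exact ⟨khat, ⟨CirclePattern.isDegenerated_of_mem_stratum hI' hkI, hkL⟩,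
    fun k' hk' => hunique k' hk'.1, hkI, hflow⟩
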